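/- **Setting.** A partial monitoring game $\mathcal G=(\mathcal L,\Phi)$ has a loss matrix $\mathcal L\in[0,1]^{k\times d}$ with rows $\ell_1,\dots,\ell_k$ and a feedback matrix $\Phi\in\Sigma^{k\times d}$, where $k,d\ge 1$ and $\Sigma$ is finite; it is assumed that $\ell_a\ne\ell_b$ for $a\neq b$ (no duplicate actions). In each round $t=1,\dots,T$, $T\ge 3$, the opponent chooses an outcome $x_t\in[d]$ (possibly at random, depending on past actions and outcomes), the learner, who knows $\mathcal L$ and $\Phi$, chooses at random an action $A_t\in[k]$ depending on past actions and observed symbols, and observes $\sigma_t=\Phi_{A_tx_t}$; given the past, $x_t$ and $A_t$ are independent. The regret is $R_T=\max_{a\in[k]}\mathbb E\big[\sum_{t=1}^T(\mathcal L_{A_tx_t}-\mathcal L_{ax_t})\big]$. Let $\mathcal P_d$ be the probability simplex, $\mathcal C_a=\{u\in\mathcal P_d:(\ell_a-\ell_b)^\top u\le 0\ \forall b\}$, and let $\Pi$ be the set of (Pareto optimal) actions with $\dim\mathcal C_a=d-1$, $k_\Pi=|\Pi|$. Distinct $a,b\in\Pi$ are neighbours if $\mathcal C_a\cap\mathcal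 C_b$ is non-empty of dimension $d-2$. The game is globally observable if for all neighbours $a,b$ there is $w_{ab}:[k]\times\Sigma\to\mathbb R$ with $\sum_{c=1}^k w_{ab}(c,\Phi_{cx})=\mathcal L_{ax}-\mathcal L_{bx}$ for all $x\in[d]$. Given such functions, a spanning tree of the neighbourhood graph on $\Pi$ and a root, let $G(a,\sigma)_b=\sum_{e}w_e(a,\sigma)$ for $b\in\Pi$, the sum running over the edges, oriented towards the root, of the path in the tree from $b$ to the root, and $G(a,\sigma)_b=0$ for $b\notin\Pi$. Let $c_{\mathcal G}=\max\{1,k\|G\|_\infty\}$, where $\|G\|_\infty=\max_{a,\sigma,b}|G(a,\sigma)_b|$, and $X_T=c_{\mathcal G}^2\log(T)\log(k_\Pi T)$. **Algorithm.** Parameters: $c_1\ge\max\{1,\log k_\Pi\}$ and $c_2>0$. Start with $\beta_1=\max\{c_2,2c_{\mathcal G}\}$. In round $t$ let, for $a \in [k]$, $$q_{t,a}=\frac{\mathbf 1[a\in\Pi]\exp(-\beta_t^{-1}\sum_{s<t}\hat y_{s,a})}{\sum_{b\in\Pi}\exp(-\beta_t^{-1}\sum_{s<t}\hat y_{s,b})},\quad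 a_t=-\sum_{a\in\Pi}q_{t,a}\log q_{t,a},\quad b_t=1-\max_{a\in\Pi}q_{t,a},$$ $$\gamma_t'=\frac14\,\frac{c_1b_t}{c_1+(\sum_{s\le t}b_s)^{1/3}},\qquad \gamma_t=\gamma_t'+\frac{c_{\mathcal G}}{2\beta_t},\qquad p_t=(1-\gamma_t)q_t+\frac{\gamma_t}{k}\mathbf 1 ,$$ draw $A_t\sim p_t$, observe $\sigma_t$, put $\hat y_t=G(A_t,\sigma_t)/p_{t,A_t}\in\mathbb R^k$ and $$\beta_{t+1}=\beta_t+\frac{c_2\,b_t}{\gamma_t'\,\big(c_1+\sum_{s=1}^{t-1}b_sa_{s+1}/\gamma_s'\big)^{1/2}} .$$ (If $k_\Pi=1$, so that $b_t=\gamma'_t=0$, the quotient $b_t/\gamma_t'$ is read as $4\big(c_1+(\sum_{s\le t}b_s)^{1/3}\big)/c_1$, its value whenever $b_t\ne 0$.) **Regimes.** In the adversarial regime the opponent is arbitrary. For $\Delta\in[0,1]^k$ and $C\ge 0$, the opponent is an adversarial regime with a $(\Delta,C,T)$ self-bounding constraint if $R_T\ge\mathbb E\big[\sum_{t=1}^T\Delta_{A_t}-C\big]$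 for every algorithm of the learner. **Theorem.** For all constants $0<\kappa_1\le\kappa_1'$ and $0<\kappa_2\le\kappa_2'$ there is a constant $K>0$, depending only on these four numbers, such that the following holds. Take any globally observable partial monitoring game without duplicate actions. Then a function $G$ as above exists; for every such $G$, every $T\ge3$ and all $c_1\ge\max\{1,\log k_\Pi\}$ and $c_2$ with $$\kappa_1X_T^{1/3}\le c_1\le\kappa_1'X_T^{1/3},\qquad \kappa_2\sqrt{c_{\mathcal G}^2\log T}\le c_2\le\kappa_2'\sqrt{c_{\mathcal G}^2\log T},$$ the $p_t$ of the algorithm are probability vectors, and the regret of the algorithm satisfies: 1. In every adversarial regime with a $(\Delta,C,T)$ self-bounding constraint, and for every action $a^*$ with $\Delta_a>0$ for all $a\ne a^*$, writing $\Delta_{\min}=\min_{a\ne a^*}\Delta_a$, $$R_T\le K\left(\frac{c_{\mathcal G}^2\log(T)\log(k_\Pi T)}{\Delta_{\min}^2}+\left(\frac{C^2c_{\mathcal G}^2\log(T)\log(k_\Pi T)}{\Delta_{\min}^2}\right)^{1/3}\right)$$ (if $k=1$, there is no gap and $R_T=0$). 2. In the adversarial regime, $$R_T\le K\,\big(c_{\mathcal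 G}^2\log(T)\log(k_\Pi T)\big)^{1/3}\,T^{2/3}.$$ -/

import Mathlib

/-- A partial monitoring game with `k` actions, `d` outcomes and feedback symbols in `S`: a loss
matrix with entries in `[0,1]` and a feedback matrix with entries in `S`. -/
structure PMGame (k d : ℕ) (S : Type*) where
  loss : Matrix (Fin k) (Fin d) ℝ
  loss_mem : ∀ a x, loss a x ∈ Set.Icc (0 : ℝ) 1
  feedback : Matrix (Fin k) (Fin d) S

namespace PMGame

variable {k d : ℕ} {S : Type*}

/-! ### Structure of the game -/

/-- Different actions never have the same row of losses. -/
def NoDuplicates (𝒢 : PMGame k d S) : Prop :=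
  ∀ a b, a ≠ b → 𝒢.loss a ≠ 𝒢.loss b

/-- The cell of `a`: the outcome distributions under which `a` is optimal. -/
def cell (𝒢 : PMGame k d S) (a : Fin k) : Set (Fin d → ℝ) :=
  {u | u ∈ stdSimplex ℝ (Fin d) ∧ ∀ b, ∑ x, (𝒢.loss a x - 𝒢.loss b x) * u x ≤ 0}

/-- The set `s` is non-empty and its affine hull has dimension `n`. -/
def HasAffineDim (s : Set (Fin d → ℝ)) (n : ℤ) : Prop :=
  s.Nonempty ∧ (Module.finrank ℝ (vectorSpan ℝ s) : ℤ) = n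

open Classical in
/-- The set `Π` of Pareto optimal actions: those whose cell has dimension `d - 1`. -/
noncomputable def pareto (𝒢 : PMGame k d S) : Finset (Fin k) :=
  Finset.univ.filter fun a => HasAffineDim (𝒢.cell a) ((d : ℤ) - 1)

/-- The neighbourhood graph on `Π`: two different Pareto optimal actions are neighbours when their
cells meet in a set of dimension `d - 2`. -/
def neighborGraph (𝒢 : PMGame k d S) : SimpleGraph {a // a ∈ 𝒢.pareto} where
  Adj a b := a ≠ b ∧ HasAffineDim (𝒢.cell a ∩ 𝒢.cell b) ((d : ℤ) - 2)
  symm := ⟨fun a b h => ⟨h.1.symm, Set.inter_comm (𝒢.cell a) (𝒢.cell b) ▸ h.2⟩⟩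
  loopless := ⟨fun _ h => h.1 rfl⟩

/-- `v c σ` recovers the loss difference of `a` and `b` from the feedback of all actions `c`. -/
def Recovers (𝒢 : PMGame k d S) (a b : Fin k) (v : Fin k → S → ℝ) : Prop :=
  ∀ x, ∑ c, v c (𝒢.feedback c x) = 𝒢.loss a x - 𝒢.loss b x

/-- Global observability: the loss difference of any two neighbours can be recovered. -/
def GloballyObservable (𝒢 : PMGame k d S) : Prop :=
  ∀ a b, 𝒢.neighborGraph.Adj a b → ∃ v, 𝒢.Recovers a b v

/-- `G` is a loss estimator of the path form: there are a spanning tree `τ` of the neighbourhood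
graph, a root and, for every edge `(a, b)` of `τ`, a function `w a b` that recovers the loss
difference, such that `G · · b` is, for `b ∈ Π`, the sum of the `w e` over the edges `e` of the
path in `τ` from `b` to the root (each edge oriented towards the root). The coordinates outside
`Π`, which the algorithm never uses, are set to zero. -/
def IsPathEstimator (𝒢 : PMGame k d S) (G : Fin k → S → Fin k → ℝ) : Prop :=
  ∃ (τ : SimpleGraph {a // a ∈ 𝒢.pareto}) (root : {a // a ∈ 𝒢.pareto})
    (w : Fin k → Fin k → Fin k → S → ℝ),
    τ ≤ 𝒢.neighborGraph ∧ τ.IsTree ∧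
    (∀ a b, τ.Adj a b → 𝒢.Recovers a b (w a b)) ∧
    (∀ b, ∃ p : τ.Walk b root, p.IsPath ∧
      ∀ a σ, G a σ b = (p.darts.map fun e => w e.fst e.snd a σ).sum) ∧
    ∀ b, b ∉ 𝒢.pareto → ∀ a σ, G a σ b = 0

/-- The constant `c_𝒢 = max {1, k ‖G‖_∞}` (the norm of the function space is the maximum norm
over all entries). -/
noncomputable def cG [Fintype S] (G : Fin k → S → Fin k → ℝ) : ℝ :=
  max 1 (k * ‖G‖)

/-- The quantity `c_𝒢² log(T) log(k_Π T)`. -/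
noncomputable def rate [Fintype S] (𝒢 : PMGame k d S) (G : Fin k → S → Fin k → ℝ) (T : ℕ) : ℝ :=
  cG G ^ 2 * Real.log T * Real.log (𝒢.pareto.card * T)

/-! ### The interaction of learner and opponent

Histories are lists with the most recent round first. A learner maps the past actions and observed
symbols to a distribution of its next action; an opponent maps the past actions and
outcomes to a distribution of the next outcome. -/

/-- `p` is an algorithm of the learner: after every history it gives a probability vector. -/
def IsLearner (p : List (Fin k × S) → Fin k → ℝ) : Prop :=
  ∀ h, p h ∈ stdSimplex ℝ (Fin k)

/-- `ν` is a (randomized, adaptive) opponent: after every history it gives a probability vector. -/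
def IsOpponent (ν : List (Fin k × Fin d) → Fin d → ℝ) : Prop :=
  ∀ h, ν h ∈ stdSimplex ℝ (Fin d)

/-- What the learner sees of a history of actions and outcomes. -/
def observed (𝒢 : PMGame k d S) (h : List (Fin k × Fin d)) : List (Fin k × S) :=
  h.map fun r => (r.1, 𝒢.feedback r.1 r.2)

/-- The expectation, when `h` has been played and `n` more rounds are played, of the value of `f`
at the resulting history. In a round, the outcome is drawn from `ν` and the action
from `p`, independently of each other given the past. -/
def expect (𝒢 : PMGame k d S) (p : List (Fin k × S) → Fin k → ℝ)
    (ν : List (Fin k × Fin d) → Fin d → ℝ) (f : List (Fin k × Fin d) → ℝ) :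
    ℕ → List (Fin k × Fin d) → ℝ
  | 0, h => f h
  | n + 1, h => ∑ x, ν h x * ∑ a, p (𝒢.observed h) a * expect 𝒢 p ν f n ((a, x) :: h)

/-- The regret `R_T = max_a 𝔼[∑_{t ≤ T} (loss A_t x_t - loss a x_t)]`. -/
noncomputable def regret (𝒢 : PMGame k d S) (p : List (Fin k × S) → Fin k → ℝ)
    (ν : List (Fin k × Fin d) → Fin d → ℝ) (T : ℕ) : ℝ :=
  ⨆ a : Fin k, 𝒢.expect p ν
    (fun h => (h.map fun r => 𝒢.loss r.1 r.2 - 𝒢.loss a r.2).sum) T []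

/-- The environment `ν` is an adversarial regime with a `(Δ, C, T)` self-bounding constraint:
every algorithm has `R_T ≥ 𝔼[∑_{t ≤ T} Δ_{A_t} - C]`. -/
def SelfBounding (𝒢 : PMGame k d S) (ν : List (Fin k × Fin d) → Fin d → ℝ)
    (Δ : Fin k → ℝ) (C : ℝ) (T : ℕ) : Prop :=
  ∀ p : List (Fin k × S) → Fin k → ℝ, IsLearner p →
    𝒢.expect p ν (fun h => (h.map fun r => Δ r.1).sum - C) T [] ≤ 𝒢.regret p ν T

/-- The minimum gap `Δ_min = min_{a ≠ a⋆} Δ_a`. -/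
noncomputable def gapMin (Δ : Fin k → ℝ) (aStar : Fin k) : ℝ :=
  ⨅ a : {a : Fin k // a ≠ aStar}, Δ a

/-! ### The algorithm -/

/-- The variables of the algorithm at the beginning of round `t`. -/
structure AlgState (k : ℕ) where
  /-- `∑_{s < t} ŷ_s` -/
  estSum : Fin k → ℝ
  /-- `β_t` -/
  beta : ℝ
  /-- `∑_{s < t} b_s` -/
  bSum : ℝ
  /-- `∑_{s < t} b_s a_{s+1} / γ'_s` -/
  zSum : ℝ

/-- The exponential weights `q_t` on `Π`, with learning rate `1 / β`. -/
noncomputable def expWeights (𝒢 : PMGame k d S) (est : Fin k → ℝ) (β : ℝ) (a : Fin k) : ℝ :=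
  if a ∈ 𝒢.pareto then
    Real.exp (-(1 / β) * est a) / ∑ b ∈ 𝒢.pareto, Real.exp (-(1 / β) * est b)
  else 0

/-- The Shannon entropy `- ∑_{a ∈ Π} q_a log q_a`. -/
noncomputable def entropy (𝒢 : PMGame k d S) (q : Fin k → ℝ) : ℝ :=
  -∑ a ∈ 𝒢.pareto, q a * Real.log (q a)

/-- `b_t = 1 - max_{a ∈ Π} q_{t,a}` -/
noncomputable def bOf (𝒢 : PMGame k d S) (q : Fin k → ℝ) : ℝ :=
  1 - ⨆ a : {a // a ∈ 𝒢.pareto}, q a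

/-- `γ'_t` as a function of `b = b_t` and `B = ∑_{s ≤ t} b_s`. -/
noncomputable def gammaPrime (c₁ b B : ℝ) : ℝ :=
  1 / 4 * (c₁ * b / (c₁ + B ^ (1 / 3 : ℝ)))

/-- The quotient `b_t / γ'_t` with the common factor `b_t` cancelled, see
`div_gammaPrime`. In this form it also makes sense when `b_t = 0`, which happens only if
`Π` has a single element. -/
noncomputable def bOverGammaPrime (c₁ B : ℝ) : ℝ :=
  4 * (c₁ + B ^ (1 / 3 : ℝ)) / c₁

theorem div_gammaPrime {c₁ b B : ℝ} (hb : b ≠ 0) :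
    b / gammaPrime c₁ b B = bOverGammaPrime c₁ B := by
  unfold gammaPrime bOverGammaPrime
  rw [mul_div_assoc', div_div_eq_mul_div]
  rw [show b * (c₁ + B ^ (1 / 3 : ℝ)) / (1 / 4 * (c₁ * b))
    = (4 * (c₁ + B ^ (1 / 3 : ℝ))) * b / (c₁ * b) by
      rw [show (1 / 4 * (c₁ * b)) = (c₁ * b) / 4 by ring, div_div_eq_mul_div]; ring]
  exact mul_div_mul_right _ _ hb

variable [Fintype S]

/-- `q_t` -/
noncomputable def qOf (𝒢 : PMGame k d S) (s : AlgState k) : Fin k → ℝ :=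
  𝒢.expWeights s.estSum s.beta

/-- `∑_{s ≤ t} b_s` -/
noncomputable def bSumNext (𝒢 : PMGame k d S) (s : AlgState k) : ℝ :=
  s.bSum + 𝒢.bOf (𝒢.qOf s)

/-- `γ_t = γ'_t + c_𝒢 / (2 β_t)` -/
noncomputable def gamma (𝒢 : PMGame k d S) (G : Fin k → S → Fin k → ℝ) (c₁ : ℝ)
    (s : AlgState k) : ℝ :=
  gammaPrime c₁ (𝒢.bOf (𝒢.qOf s)) (𝒢.bSumNext s) + cG G / (2 * s.beta)

/-- `p_t = (1 - γ_t) q_t + (γ_t / k) 𝟏` -/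
noncomputable def pOf (𝒢 : PMGame k d S) (G : Fin k → S → Fin k → ℝ) (c₁ : ℝ)
    (s : AlgState k) (a : Fin k) : ℝ :=
  (1 - 𝒢.gamma G c₁ s) * 𝒢.qOf s a + 𝒢.gamma G c₁ s / k

/-- `∑_{s ≤ t} ŷ_s`, where `ŷ_t = G (A_t, σ_t) / p_{t, A_t}` -/
noncomputable def estSumNext (𝒢 : PMGame k d S) (G : Fin k → S → Fin k → ℝ) (c₁ : ℝ)
    (s : AlgState k) (A : Fin k) (σ : S) (b : Fin k) : ℝ :=
  s.estSum b + G A σ b / 𝒢.pOf G c₁ s A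

/-- `β_{t+1} = β_t + c₂ b_t / (γ'_t (c₁ + ∑_{s < t} b_s a_{s+1} / γ'_s)^{1/2})` -/
noncomputable def betaNext (𝒢 : PMGame k d S) (c₁ c₂ : ℝ) (s : AlgState k) : ℝ :=
  s.beta + c₂ * bOverGammaPrime c₁ (𝒢.bSumNext s) / Real.sqrt (c₁ + s.zSum)

/-- The state of the algorithm after a history of actions and symbols (most recent first). -/
noncomputable def algState (𝒢 : PMGame k d S) (G : Fin k → S → Fin k → ℝ) (c₁ c₂ : ℝ) :
    List (Fin k × S) → AlgState k
  | [] => { estSum := 0, beta := max c₂ (2 * cG G), bSum := 0, zSum := 0 }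
  | r :: h =>
    let s := algState 𝒢 G c₁ c₂ h
    let est := 𝒢.estSumNext G c₁ s r.1 r.2
    let β := 𝒢.betaNext c₁ c₂ s
    { estSum := est
      beta := β
      bSum := 𝒢.bSumNext s
      zSum := s.zSum + bOverGammaPrime c₁ (𝒢.bSumNext s) * 𝒢.entropy (𝒢.expWeights est β) }

/-- The algorithm: the distribution `p_t` of the action after the given history. -/
noncomputable def algorithm (𝒢 : PMGame k d S) (G : Fin k → S → Fin k → ℝ) (c₁ c₂ : ℝ)
    (h : List (Fin k × S)) : Fin k → ℝ :=
  𝒢.pOf G c₁ (𝒢.algState G c₁ c₂ h)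

end PMGame

/-! Geometry. The cells of the Pareto optimal actions cover the simplex (`exists_mem_pareto_cell`),
so the regret need only be bounded against such actions: compare at the vector of expected outcome
frequencies (`exists_pareto_expect_le`). The neighbourhood graph is connected because a generic
segment between two cells crosses their boundaries one at a time (`neighborGraph_connected`). Hence
spanning trees exist, and summing along tree paths telescopes to unbiased estimates of losses
relative to the root (`IsPathEstimator.exists_root`).

Analysis. The cumulative estimate of a comparator minus the free energy is a nonnegative potential.
Its drift (`sum_pOf_mul_le`) bounds the expected regret by the initial penalty `β₁ log k_Π` plus the
expected sum of an exploration term `γ_t`, a stability term of order `c_𝒢² (b_t / γ'_t) / β_t` and a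
penalty `(β_{t+1} - β_t) a_{t+1}`. The factor `b_t` comes from centring the second-order bound at
the most likely action (`log_sum_exp_le`). The update of `β` makes all three sums telescope
(`regretBound_le`). With `X` the rate and `B = ∑ b_t`, every history of length `T` costs at most a
constant times `X + X^{1/3} B^{2/3}`.

By Young's inequality this is at most a constant times `X + X / η² + η B` for every `η > 0`, which
is affine in `B` and passes to the expectation (`IsTuned.regret_le`). In the adversarial regime `B ≤
T`, and `η` is optimized. Under a self-bounding constraint `(Δ_min / 2) 𝔼 B - C ≤ R_T`
(`expect_gap_ge`); taking `η` proportional to `Δ_min` lets the term `η 𝔼 B` be absorbed by the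
regret itself. -/

open scoped Topology
open Filter
namespace PMGame

variable {k d : ℕ} {S : Type*}

/-! ### Generic points of the simplex. -/

/-- The relative interior of the probability simplex. -/
def openSimplex (d : ℕ) : Set (Fin d → ℝ) := {u | (∀ x, 0 < u x) ∧ ∑ x, u x = 1}

theorem openSimplex_subset : openSimplex d ⊆ stdSimplex ℝ (Fin d) :=
  fun _ hu => ⟨fun x => (hu.1 x).le, hu.2⟩

theorem openSimplex_segment {u v : Fin d → ℝ} (hu : u ∈ stdSimplex ℝ (Fin d))
    (hv : v ∈ openSimplex d) {ε : ℝ} (h0 : 0 < ε) (h1 : ε ≤ 1) :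
    (1 - ε) • u + ε • v ∈ openSimplex d := by
  refine ⟨fun x => ?_, ?_⟩
  · have := hu.1 x
    have := mul_pos h0 (hv.1 x)
    have : 0 ≤ (1 - ε) * u x := mul_nonneg (by linarith) (hu.1 x)
    simp only [Pi.add_apply, Pi.smul_apply, smul_eq_mul]
    linarith
  · simp [Finset.sum_add_distrib, ← Finset.mul_sum, hu.2, hv.2]

theorem mem_cell_iff (𝒢 : PMGame k d S) (a : Fin k) (u : Fin d → ℝ) :
    u ∈ 𝒢.cell a ↔ u ∈ stdSimplex ℝ (Fin d) ∧ ∀ b, 𝒢.loss a ⬝ᵥ u ≤ 𝒢.loss b ⬝ᵥ u := by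
  simp only [cell, Set.mem_ofPred_eq, dotProduct, sub_mul, Finset.sum_sub_distrib, sub_nonpos]

theorem mem_pareto_iff (𝒢 : PMGame k d S) (a : Fin k) :
    a ∈ 𝒢.pareto ↔ HasAffineDim (𝒢.cell a) ((d : ℤ) - 1) := by
  simp [pareto]

/-- Finitely many hyperplanes through the origin do not cover the open simplex. -/
theorem exists_generic {ι : Type*} [Fintype ι] (hd : 0 < d) (n : ι → Fin d → ℝ)
    (hn : ∀ i, n i ≠ 0) : ∃ v ∈ openSimplex d, ∀ i, n i ⬝ᵥ v ≠ 0 := by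
  classical
  -- Moment curve: along `s ↦ (1, s, s², …)` the functional `n i` becomes a nonzero polynomial in
  -- `s`, with finitely many roots. A positive `s` off all roots, normalized, gives the point.
  let P : ι → Polynomial ℝ := fun i => ∑ x : Fin d, Polynomial.monomial (x : ℕ) (n i x)
  have hP : ∀ i, P i ≠ 0 := by
    intro i h
    apply hn i
    funext y
    have := congrArg (fun p => Polynomial.coeff p (y : ℕ)) h
    simpa [P, Polynomial.finsetSum_coeff, Polynomial.coeff_monomial, Fin.val_inj] using this
  obtain ⟨s, hs, hroot⟩ := (Set.Ioi_infinite (0 : ℝ)).exists_notMem_finset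
    (Finset.univ.biUnion fun i => (P i).roots.toFinset)
  have hs : 0 < s := hs
  have hN : 0 < ∑ x : Fin d, s ^ (x : ℕ) :=
    Finset.sum_pos (fun x _ => pow_pos hs _) ⟨⟨0, hd⟩, Finset.mem_univ _⟩
  refine ⟨fun x => s ^ (x : ℕ) / ∑ x : Fin d, s ^ (x : ℕ), ⟨fun x => by positivity, ?_⟩, ?_⟩
  · rw [← Finset.sum_div, div_self hN.ne']
  · intro i h
    apply hroot
    simp only [Finset.mem_biUnion, Finset.mem_univ, true_and, Multiset.mem_toFinset]
    refine ⟨i, (Polynomial.mem_roots (hP i)).2 ?_⟩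
    simp only [dotProduct, mul_div_assoc', ← Finset.sum_div, div_eq_zero_iff, hN.ne', or_false] at h
    simpa [P, Polynomial.IsRoot, Polynomial.eval_finsetSum] using h

theorem dotProduct_segment (n u v : Fin d → ℝ) (ε : ℝ) :
    n ⬝ᵥ ((1 - ε) • u + ε • v) = (1 - ε) * n ⬝ᵥ u + ε * n ⬝ᵥ v := by
  simp [dotProduct_add, dotProduct_smul]

theorem eventually_segment_pos {α β : ℝ} (h : 0 < α) :
    ∀ᶠ ε in 𝓝[>] (0 : ℝ), 0 < (1 - ε) * α + ε * β := by
  have hc : ContinuousAt (fun ε : ℝ => (1 - ε) * α + ε * β) 0 := by fun_prop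
  exact (hc.eventually (lt_mem_nhds (by simpa using h))).filter_mono nhdsWithin_le_nhds

theorem eventually_segment_ne {α β : ℝ} (h : β ≠ 0) :
    ∀ᶠ ε in 𝓝[>] (0 : ℝ), (1 - ε) * α + ε * β ≠ 0 := by
  rcases lt_trichotomy α 0 with hα | rfl | hα
  · filter_upwards [eventually_segment_pos (β := -β) (neg_pos.2 hα)] with ε hε h0
    linarith
  · filter_upwards [self_mem_nhdsWithin] with ε hε
    have : ε ≠ 0 := ne_of_gt hε
    simp [this, h]
  · filter_upwards [eventually_segment_pos (β := β) hα] with ε hε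
    exact hε.ne'

theorem eventually_small : ∀ᶠ ε in 𝓝[>] (0 : ℝ), 0 < ε ∧ ε ≤ 1 := by
  filter_upwards [Ioc_mem_nhdsGT (zero_lt_one (α := ℝ))] with ε hε using hε

/-- Near a point of the simplex there are generic interior points. -/
theorem exists_generic_near {ι κ : Type*} [Fintype ι] [Finite κ] (hd : 0 < d)
    (n : ι → Fin d → ℝ) (hn : ∀ i, n i ≠ 0) (m : κ → Fin d → ℝ) {u : Fin d → ℝ}
    (hu : u ∈ stdSimplex ℝ (Fin d)) (hm : ∀ j, 0 < m j ⬝ᵥ u) :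
    ∃ v ∈ openSimplex d, (∀ j, 0 < m j ⬝ᵥ v) ∧ ∀ i, n i ⬝ᵥ v ≠ 0 := by
  obtain ⟨v, hv, hvn⟩ := exists_generic hd n hn
  have h1 : ∀ᶠ ε in 𝓝[>] (0 : ℝ), ∀ j, 0 < (1 - ε) * m j ⬝ᵥ u + ε * m j ⬝ᵥ v :=
    eventually_all.2 fun j => eventually_segment_pos (hm j)
  have h2 : ∀ᶠ ε in 𝓝[>] (0 : ℝ), ∀ i, (1 - ε) * n i ⬝ᵥ u + ε * n i ⬝ᵥ v ≠ 0 :=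
    eventually_all.2 fun i => eventually_segment_ne (hvn i)
  obtain ⟨ε, ⟨h1, h2⟩, h0, hε⟩ := ((h1.and h2).and eventually_small).exists
  exact ⟨_, openSimplex_segment hu hv h0 hε, fun j => by rw [dotProduct_segment]; exact h1 j,
    fun i => by rw [dotProduct_segment]; exact h2 i⟩

/-! ### Dimensions -/

/-- The sum of the coordinates as a linear functional. -/
def sumForm (d : ℕ) : (Fin d → ℝ) →ₗ[ℝ] ℝ := ∑ x, LinearMap.proj x

theorem sumForm_apply (u : Fin d → ℝ) : sumForm d u = ∑ x, u x := by simp [sumForm]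

/-- The functional `u ↦ ⟨n, u⟩`. -/
def dotForm (n : Fin d → ℝ) : (Fin d → ℝ) →ₗ[ℝ] ℝ := ∑ x, n x • LinearMap.proj x

theorem dotForm_apply (n u : Fin d → ℝ) : dotForm n u = n ⬝ᵥ u := by
  simp [dotForm, dotProduct]

theorem prodForm_apply (n u : Fin d → ℝ) :
    ((dotForm n).prod (sumForm d)) u = (n ⬝ᵥ u, ∑ x, u x) :=
  Prod.ext (dotForm_apply n u) (sumForm_apply u)

theorem finrank_ker_sumForm (hd : 0 < d) :
    (Module.finrank ℝ (LinearMap.ker (sumForm d)) : ℤ) = d - 1 := by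
  have hs : Function.Surjective (sumForm d) := fun r =>
    ⟨Pi.single ⟨0, hd⟩ r, by simp [sumForm_apply]⟩
  have := (sumForm d).finrank_range_add_finrank_ker
  rw [LinearMap.range_eq_top.2 hs] at this
  simp at this
  omega

/-- The point `w` makes the two functionals independent: `n` adjusts the first coordinate, and `w`
then corrects the coordinate sum without disturbing it. -/
theorem finrank_ker_prod {n w : Fin d → ℝ} (hn : n ≠ 0) (hw : ∑ x, w x = 1) (hnw : n ⬝ᵥ w = 0) :
    (Module.finrank ℝ (LinearMap.ker ((dotForm n).prod (sumForm d))) : ℤ) = d - 2 := by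
  have hy : n ⬝ᵥ n ≠ 0 := fun h => hn (dotProduct_self_eq_zero.1 h)
  have hs : Function.Surjective ((dotForm n).prod (sumForm d)) := fun r => by
    refine ⟨(r.1 / n ⬝ᵥ n) • n + (r.2 - (r.1 / n ⬝ᵥ n) * ∑ x, n x) • w, ?_⟩
    rw [prodForm_apply]
    ext
    · simp [dotProduct_add, dotProduct_smul, hnw, hy]
    · simp [Finset.sum_add_distrib, ← Finset.mul_sum, hw]
  have := ((dotForm n).prod (sumForm d)).finrank_range_add_finrank_ker
  rw [LinearMap.range_eq_top.2 hs] at this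
  simp at this
  omega

theorem vectorSpan_le_ker {E : Type*} [AddCommGroup E] [Module ℝ E] (f : (Fin d → ℝ) →ₗ[ℝ] E)
    {s : Set (Fin d → ℝ)} {e : E} (h : ∀ u ∈ s, f u = e) : vectorSpan ℝ s ≤ LinearMap.ker f := by
  rw [vectorSpan_def, Submodule.span_le]
  rintro _ ⟨u, hu, v, hv, rfl⟩
  simp [h u hu, h v hv]

/-- If `s` lies in a fibre of `f` and contains a neighbourhood of `w` in it, then its direction is
the kernel of `f`. -/
theorem vectorSpan_eq_ker {E : Type*} [AddCommGroup E] [Module ℝ E] (f : (Fin d → ℝ) →ₗ[ℝ] E)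
    {s : Set (Fin d → ℝ)} {e : E} {w : Fin d → ℝ} (h : ∀ u ∈ s, f u = e) (hw : w ∈ s)
    (hs : ∀ v, f v = 0 → ∀ᶠ ε in 𝓝[>] (0 : ℝ), w + ε • v ∈ s) :
    vectorSpan ℝ s = LinearMap.ker f := by
  refine le_antisymm (vectorSpan_le_ker f h) fun v hv => ?_
  obtain ⟨ε, hε, h0, -⟩ := ((hs v hv).and eventually_small).exists
  have := vsub_mem_vectorSpan ℝ hε hw
  simp only [vsub_eq_sub, add_sub_cancel_left] at this
  exact (Submodule.smul_mem_iff _ h0.ne').1 this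

theorem eventually_add_smul_pos {α β : ℝ} (h : 0 < α) : ∀ᶠ ε in 𝓝[>] (0 : ℝ), 0 < α + ε * β := by
  have hc : ContinuousAt (fun ε : ℝ => α + ε * β) 0 := by fun_prop
  exact (hc.eventually (lt_mem_nhds (by simpa using h))).filter_mono nhdsWithin_le_nhds

theorem eventually_mem_openSimplex {w v : Fin d → ℝ} (hw : w ∈ openSimplex d)
    (hv : ∑ x, v x = 0) : ∀ᶠ ε in 𝓝[>] (0 : ℝ), w + ε • v ∈ openSimplex d := by
  have h : ∀ᶠ ε in 𝓝[>] (0 : ℝ), ∀ x, 0 < w x + ε * v x :=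
    eventually_all.2 fun x => eventually_add_smul_pos (hw.1 x)
  filter_upwards [h] with ε hε
  refine ⟨hε, ?_⟩
  simp [Finset.sum_add_distrib, ← Finset.mul_sum, hw.2, hv]

/-! ### Pareto optimal actions -/

/-- Finitely many strict inequalities survive small moves in every direction of coordinate sum zero,
so the cell contains a relative neighbourhood of `u`. -/
theorem mem_pareto_of_strict (𝒢 : PMGame k d S) (hd : 0 < d) {a : Fin k} {u : Fin d → ℝ}
    (hu : u ∈ openSimplex d) (h : ∀ b, b ≠ a → 𝒢.loss a ⬝ᵥ u < 𝒢.loss b ⬝ᵥ u) :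
    a ∈ 𝒢.pareto := by
  have hua : u ∈ 𝒢.cell a := (𝒢.mem_cell_iff a u).2 ⟨openSimplex_subset hu, fun b => by
    by_cases hb : b = a
    · rw [hb]
    · exact (h b hb).le⟩
  refine (𝒢.mem_pareto_iff a).2 ⟨⟨u, hua⟩, ?_⟩
  rw [vectorSpan_eq_ker (sumForm d) (e := 1) (fun v hv => by rw [sumForm_apply]; exact hv.1.2) hua,
    finrank_ker_sumForm hd]
  intro v hv
  rw [sumForm_apply] at hv
  have h2 : ∀ᶠ ε in 𝓝[>] (0 : ℝ), ∀ b, b ≠ a →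
      0 < (𝒢.loss b ⬝ᵥ u - 𝒢.loss a ⬝ᵥ u) + ε * (𝒢.loss b ⬝ᵥ v - 𝒢.loss a ⬝ᵥ v) :=
    eventually_all.2 fun b => eventually_imp_distrib_left.2 fun hb =>
      eventually_add_smul_pos (sub_pos.2 (h b hb))
  filter_upwards [eventually_mem_openSimplex hu hv, h2] with ε h1 h2
  refine (𝒢.mem_cell_iff a _).2 ⟨openSimplex_subset h1, fun b => ?_⟩
  by_cases hb : b = a
  · rw [hb]
  · have := h2 b hb
    simp only [dotProduct_add, dotProduct_smul, smul_eq_mul]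
    linarith

/-- A cell of full dimension is not contained in a hyperplane. -/
theorem exists_dotProduct_ne_zero (𝒢 : PMGame k d S) {a : Fin k} (ha : a ∈ 𝒢.pareto)
    {n : Fin d → ℝ} (hn : n ≠ 0) : ∃ u ∈ 𝒢.cell a, n ⬝ᵥ u ≠ 0 := by
  by_contra! h
  obtain ⟨⟨w, hw⟩, hdim⟩ := (𝒢.mem_pareto_iff a).1 ha
  have h1 := finrank_ker_prod hn hw.1.2 (h w hw)
  have h2 : vectorSpan ℝ (𝒢.cell a) ≤ LinearMap.ker ((dotForm n).prod (sumForm d)) :=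
    vectorSpan_le_ker (e := ((0 : ℝ), (1 : ℝ))) _ fun u hu => by
      ext
      · simp [dotForm_apply, h u hu]
      · simpa [sumForm_apply] using hu.1.2
  have h3 := Submodule.finrank_mono h2
  omega

theorem cell_convex (𝒢 : PMGame k d S) (a : Fin k) : Convex ℝ (𝒢.cell a) := by
  intro u hu v hv s t hs ht hst
  rw [mem_cell_iff] at *
  refine ⟨convex_stdSimplex ℝ _ hu.1 hv.1 hs ht hst, fun b => ?_⟩
  simp only [dotProduct_add, dotProduct_smul, smul_eq_mul]
  exact add_le_add (mul_le_mul_of_nonneg_left (hu.2 b) hs) (mul_le_mul_of_nonneg_left (hv.2 b) ht)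

/-- Finitely many nonzero functionals that are nonnegative on a cell of full dimension are
simultaneously positive at some point of the cell. -/
theorem exists_pos_of_nonneg (𝒢 : PMGame k d S) {a : Fin k} (ha : a ∈ 𝒢.pareto) {ι : Type*}
    (I : Finset ι) (n : ι → Fin d → ℝ) (hn : ∀ i ∈ I, n i ≠ 0)
    (hpos : ∀ i ∈ I, ∀ u ∈ 𝒢.cell a, 0 ≤ n i ⬝ᵥ u) :
    ∃ u ∈ 𝒢.cell a, ∀ i ∈ I, 0 < n i ⬝ᵥ u := by
  classical
  induction I using Finset.induction_on with
  | empty =>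
    obtain ⟨u, hu⟩ := ((𝒢.mem_pareto_iff a).1 ha).1
    exact ⟨u, hu, by simp⟩
  | insert j I hj ih =>
    obtain ⟨u, hu, hI⟩ := ih (fun i hi => hn i (Finset.mem_insert_of_mem hi))
      (fun i hi => hpos i (Finset.mem_insert_of_mem hi))
    obtain ⟨v, hv, hvj⟩ := 𝒢.exists_dotProduct_ne_zero ha (hn j (Finset.mem_insert_self _ _))
    have hvj' := lt_of_le_of_ne (hpos j (Finset.mem_insert_self _ _) v hv) hvj.symm
    refine ⟨(1 / 2 : ℝ) • u + (1 / 2 : ℝ) • v, 𝒢.cell_convex a hu hv (by norm_num) (by norm_num)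
      (by norm_num), fun i hi => ?_⟩
    have h1 := hpos i hi u hu
    have h2 := hpos i hi v hv
    simp only [dotProduct_add, dotProduct_smul, smul_eq_mul]
    rcases Finset.mem_insert.1 hi with rfl | hi
    · linarith
    · have := hI i hi
      linarith

/-- Coordinates and loss differences to `a` are nonnegative on the cell of `a`; the latter are
nonzero functionals because there are no duplicates. A point where all are positive is interior and
has `a` as unique minimizer. -/
theorem exists_strict_of_mem_pareto (𝒢 : PMGame k d S) (hdup : 𝒢.NoDuplicates) {a : Fin k}
    (ha : a ∈ 𝒢.pareto) :
    ∃ u ∈ openSimplex d, ∀ b, b ≠ a → 𝒢.loss a ⬝ᵥ u < 𝒢.loss b ⬝ᵥ u := by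
  classical
  obtain ⟨u, hu, hpos⟩ := 𝒢.exists_pos_of_nonneg ha
    (Finset.univ.filter fun i : Fin d ⊕ Fin k => i ≠ Sum.inr a)
    (Sum.elim (fun x => Pi.single x 1) fun b => 𝒢.loss b - 𝒢.loss a)
    (by
      rintro (x | b) hi
      · simp
      · simp only [Finset.mem_filter, Finset.mem_univ, true_and, ne_eq, Sum.inr.injEq] at hi
        simpa [sub_eq_zero] using hdup b a hi)
    (by
      rintro (x | b) - u hu
      · simpa using hu.1.1 x
      · simpa [sub_dotProduct] using ((𝒢.mem_cell_iff a u).1 hu).2 b)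
  refine ⟨u, ⟨fun x => ?_, hu.1.2⟩, fun b hb => ?_⟩
  · simpa using hpos (Sum.inl x) (by simp)
  · simpa [sub_dotProduct] using hpos (Sum.inr b) (by simpa using hb)

/-- The cells of the Pareto optimal actions cover the simplex. -/
theorem exists_mem_pareto_cell (𝒢 : PMGame k d S) (hk : 0 < k) (hd : 0 < d)
    (hdup : 𝒢.NoDuplicates) {u : Fin d → ℝ} (hu : u ∈ stdSimplex ℝ (Fin d)) :
    ∃ a ∈ 𝒢.pareto, u ∈ 𝒢.cell a := by
  obtain ⟨v, hv, hvn⟩ := exists_generic hd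
    (fun i : {i : Fin k × Fin k // i.1 ≠ i.2} => 𝒢.loss i.1.1 - 𝒢.loss i.1.2)
    (fun i => sub_ne_zero.2 (hdup _ _ i.2))
  have : Nonempty (Fin k) := ⟨⟨0, hk⟩⟩
  -- Ties at `u` are broken by the generic `v`: the lexicographic minimizer is optimal at `u` and
  -- strictly optimal just off `u` in the direction of `v`, hence Pareto optimal.
  obtain ⟨a, -, ha⟩ := Finset.exists_min_image Finset.univ
    (fun a => toLex (𝒢.loss a ⬝ᵥ u, 𝒢.loss a ⬝ᵥ v)) Finset.univ_nonempty
  have ha' : ∀ b, 𝒢.loss a ⬝ᵥ u < 𝒢.loss b ⬝ᵥ u ∨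
      𝒢.loss a ⬝ᵥ u = 𝒢.loss b ⬝ᵥ u ∧ 𝒢.loss a ⬝ᵥ v ≤ 𝒢.loss b ⬝ᵥ v := fun b => by
    simpa [Prod.Lex.toLex_le_toLex] using ha b (Finset.mem_univ b)
  have hs : ∀ᶠ ε in 𝓝[>] (0 : ℝ), ∀ b, b ≠ a →
      0 < (1 - ε) * (𝒢.loss b - 𝒢.loss a) ⬝ᵥ u + ε * (𝒢.loss b - 𝒢.loss a) ⬝ᵥ v := by
    refine eventually_all.2 fun b => eventually_imp_distrib_left.2 fun hb => ?_
    rcases ha' b with h | ⟨h1, h2⟩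
    · exact eventually_segment_pos (by rw [sub_dotProduct]; linarith)
    · have h3 := hvn ⟨(b, a), hb⟩
      simp only [sub_dotProduct] at h3 ⊢
      filter_upwards [self_mem_nhdsWithin] with ε hε
      rw [h1, sub_self, mul_zero, zero_add]
      exact mul_pos hε (lt_of_le_of_ne (by linarith) h3.symm)
  obtain ⟨ε, hs, h0, h1⟩ := (hs.and eventually_small).exists
  refine ⟨a, 𝒢.mem_pareto_of_strict hd (openSimplex_segment hu hv h0 h1) fun b hb => ?_,
    (𝒢.mem_cell_iff a u).2 ⟨hu, fun b => (ha' b).elim le_of_lt fun h => h.1.le⟩⟩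
  have := hs b hb
  rw [← dotProduct_segment, sub_dotProduct] at this
  linarith

theorem pareto_nonempty (𝒢 : PMGame k d S) (hk : 0 < k) (hd : 0 < d) (hdup : 𝒢.NoDuplicates) :
    𝒢.pareto.Nonempty := by
  obtain ⟨v, hv, -⟩ := exists_generic (ι := Empty) hd (fun i => i.elim) (fun i => i.elim)
  obtain ⟨a, ha, -⟩ := 𝒢.exists_mem_pareto_cell hk hd hdup (openSimplex_subset hv)
  exact ⟨a, ha⟩

/-! ### The neighbourhood graph -/

/-- Comparison with Pareto optimal actions suffices, since one of them is optimal at every point.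
Near `w`, inside the hyperplane where `a` and `b` tie, the strict inequalities persist, so the
common face has the full direction of that hyperplane in the simplex. -/
theorem neighbors_of_tie (𝒢 : PMGame k d S) (hk : 0 < k) (hd : 0 < d) (hdup : 𝒢.NoDuplicates)
    {a b : {a // a ∈ 𝒢.pareto}} (hab : a ≠ b) {w : Fin d → ℝ} (hw : w ∈ openSimplex d)
    (heq : 𝒢.loss a ⬝ᵥ w = 𝒢.loss b ⬝ᵥ w)
    (hlt : ∀ c ∈ 𝒢.pareto, c ≠ a → c ≠ b → 𝒢.loss a ⬝ᵥ w < 𝒢.loss c ⬝ᵥ w) :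
    𝒢.neighborGraph.Adj a b := by
  have hmem : ∀ u ∈ stdSimplex ℝ (Fin d), 𝒢.loss a ⬝ᵥ u = 𝒢.loss b ⬝ᵥ u →
      (∀ c ∈ 𝒢.pareto, c ≠ a → c ≠ b → 𝒢.loss a ⬝ᵥ u ≤ 𝒢.loss c ⬝ᵥ u) →
      u ∈ 𝒢.cell a ∩ 𝒢.cell b := by
    intro u hu h1 h2
    have h3 : ∀ c, 𝒢.loss a ⬝ᵥ u ≤ 𝒢.loss c ⬝ᵥ u := by
      intro c
      obtain ⟨o, ho, huo⟩ := 𝒢.exists_mem_pareto_cell hk hd hdup hu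
      refine le_trans ?_ (((𝒢.mem_cell_iff o u).1 huo).2 c)
      by_cases hoa : o = a
      · rw [hoa]
      by_cases hob : o = b
      · rw [hob, h1]
      exact h2 o ho hoa hob
    exact ⟨(𝒢.mem_cell_iff _ u).2 ⟨hu, h3⟩, (𝒢.mem_cell_iff _ u).2 ⟨hu, fun c => h1 ▸ h3 c⟩⟩
  have hww := hmem w (openSimplex_subset hw) heq fun c hc h1 h2 => (hlt c hc h1 h2).le
  have hn : 𝒢.loss a - 𝒢.loss b ≠ 0 := sub_ne_zero.2 (hdup _ _ fun h => hab (Subtype.ext h))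
  refine ⟨hab, ⟨w, hww⟩, ?_⟩
  rw [vectorSpan_eq_ker ((dotForm (𝒢.loss a - 𝒢.loss b)).prod (sumForm d)) (e := (0, 1)) ?_ hww ?_,
    finrank_ker_prod hn hw.2 (by rw [sub_dotProduct, heq, sub_self])]
  · rintro u ⟨h1, h2⟩
    ext
    · have h3 := ((𝒢.mem_cell_iff _ u).1 h1).2 b
      have h4 := ((𝒢.mem_cell_iff _ u).1 h2).2 a
      simp [dotForm_apply, sub_dotProduct, le_antisymm h3 h4]
    · simpa [sumForm_apply] using h1.1.2
  · intro v hv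
    rw [prodForm_apply, Prod.mk_eq_zero, sub_dotProduct] at hv
    have h2 : ∀ᶠ ε in 𝓝[>] (0 : ℝ), ∀ c ∈ 𝒢.pareto, c ≠ a → c ≠ b →
        0 < (𝒢.loss c ⬝ᵥ w - 𝒢.loss a ⬝ᵥ w) + ε * (𝒢.loss c ⬝ᵥ v - 𝒢.loss a ⬝ᵥ v) :=
      eventually_all.2 fun c => eventually_imp_distrib_left.2 fun hc =>
        eventually_imp_distrib_left.2 fun h1 => eventually_imp_distrib_left.2 fun h2 =>
          eventually_add_smul_pos (sub_pos.2 (hlt c hc h1 h2))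
    filter_upwards [eventually_mem_openSimplex hw hv.2, h2] with ε h1 h2
    refine hmem _ (openSimplex_subset h1) ?_ fun c hc hca hcb => ?_
    · simp only [dotProduct_add, dotProduct_smul, smul_eq_mul, heq, sub_eq_zero.1 hv.1]
    · have := h2 c hc hca hcb
      simp only [dotProduct_add, dotProduct_smul, smul_eq_mul]
      linarith

/-- The loss vectors of three Pareto optimal actions are not collinear. -/
theorem not_collinear (𝒢 : PMGame k d S) (hdup : 𝒢.NoDuplicates) {a b c : Fin k}
    (ha : a ∈ 𝒢.pareto) (hb : b ∈ 𝒢.pareto) (hc : c ∈ 𝒢.pareto) (hab : a ≠ b) (hac : a ≠ c)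
    (hbc : b ≠ c) (r : ℝ) : 𝒢.loss a - 𝒢.loss c ≠ r • (𝒢.loss a - 𝒢.loss b) := by
  intro h
  have h' : ∀ u, 𝒢.loss a ⬝ᵥ u - 𝒢.loss c ⬝ᵥ u = r * (𝒢.loss a ⬝ᵥ u - 𝒢.loss b ⬝ᵥ u) := fun u => by
    rw [← sub_dotProduct, h, smul_dotProduct, sub_dotProduct, smul_eq_mul]
  obtain ⟨u, -, hu⟩ := 𝒢.exists_strict_of_mem_pareto hdup ha
  obtain ⟨v, -, hv⟩ := 𝒢.exists_strict_of_mem_pareto hdup hb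
  obtain ⟨w, -, hw⟩ := 𝒢.exists_strict_of_mem_pareto hdup hc
  have u1 := hu b hab.symm
  have u2 := hu c hac.symm
  have v1 := hv a hab
  have v2 := hv c hbc.symm
  have w1 := hw a hac
  have w2 := hw b hbc
  have hu' := h' u
  have hv' := h' v
  have hw' := h' w
  -- Of three collinear loss vectors the middle one is never the strict minimizer. According as `r ≤
  -- 0`, `1 ≤ r` or `0 < r < 1`, the middle action is `a`, `b` or `c`.
  have hr0 : 0 < r := by
    by_contra! hr
    nlinarith
  have hr1 : r < 1 := by
    by_contra! hr
    nlinarith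
  nlinarith

/-- If `b` is not reachable from `a`, join a point where `a` is strictly best to one where `b` is.
The best loss among actions reachable from `a` and the best loss among the others agree somewhere on
the segment. By genericity the tie there involves only two actions, which are therefore neighbours
on different sides, a contradiction. -/
theorem neighborGraph_connected (𝒢 : PMGame k d S) (hk : 0 < k) (hd : 0 < d)
    (hdup : 𝒢.NoDuplicates) : 𝒢.neighborGraph.Connected := by
  classical
  obtain ⟨a₀, ha₀⟩ := 𝒢.pareto_nonempty hk hd hdup
  have : Nonempty {a // a ∈ 𝒢.pareto} := ⟨⟨a₀, ha₀⟩⟩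
  refine ⟨fun a b => ?_⟩
  by_contra hreach
  obtain ⟨u₀, hu₀, hua₀⟩ := 𝒢.exists_strict_of_mem_pareto hdup a.2
  obtain ⟨v₀, hv₀, hvb₀⟩ := 𝒢.exists_strict_of_mem_pareto hdup b.2
  obtain ⟨u, hu, hua, hun⟩ := exists_generic_near hd
    (fun i : {i : Fin k × Fin k // i.1 ≠ i.2} => 𝒢.loss i.1.1 - 𝒢.loss i.1.2)
    (fun i => sub_ne_zero.2 (hdup _ _ i.2))
    (fun c : {c : Fin k // c ≠ a} => 𝒢.loss c - 𝒢.loss a) (openSimplex_subset hu₀)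
    (fun c => by rw [sub_dotProduct, sub_pos]; exact hua₀ c c.2)
  -- These functionals of `v` are the determinants that vanish when the differences `c - e` and `c -
  -- f` have a common zero on the segment from `u` to `v`. They are nonzero by `not_collinear` and
  -- the genericity of `u`.
  obtain ⟨v, hv, hvb, hvn⟩ := exists_generic_near hd
    (fun i : {i : {a // a ∈ 𝒢.pareto} × {a // a ∈ 𝒢.pareto} × {a // a ∈ 𝒢.pareto} //
        i.1 ≠ i.2.1 ∧ i.1 ≠ i.2.2 ∧ i.2.1 ≠ i.2.2} =>
      ((𝒢.loss i.1.1 - 𝒢.loss i.1.2.1) ⬝ᵥ u) • (𝒢.loss i.1.1 - 𝒢.loss i.1.2.2) -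
      ((𝒢.loss i.1.1 - 𝒢.loss i.1.2.2) ⬝ᵥ u) • (𝒢.loss i.1.1 - 𝒢.loss i.1.2.1))
    (by
      rintro ⟨⟨c, e, f⟩, hce, hcf, hef⟩ h0
      have hce' : (c : Fin k) ≠ e := fun h => hce (Subtype.ext h)
      have hne := hun ⟨(c, e), hce'⟩
      refine 𝒢.not_collinear hdup c.2 e.2 f.2 hce' (fun h => hcf (Subtype.ext h))
        (fun h => hef (Subtype.ext h))
        (((𝒢.loss c - 𝒢.loss f) ⬝ᵥ u) / ((𝒢.loss c - 𝒢.loss e) ⬝ᵥ u)) ?_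
      rw [div_eq_inv_mul, mul_smul, ← sub_eq_zero.1 h0, smul_smul, inv_mul_cancel₀ hne, one_smul])
    (fun c : {c : Fin k // c ≠ b} => 𝒢.loss c - 𝒢.loss b) (openSimplex_subset hv₀)
    (fun c => by rw [sub_dotProduct, sub_pos]; exact hvb₀ c c.2)
  let w : ℝ → Fin d → ℝ := fun t => (1 - t) • u + t • v
  have hwc : ∀ n : Fin d → ℝ, Continuous fun t => n ⬝ᵥ w t := fun n => by
    simp only [w, dotProduct_segment]
    fun_prop
  let R : Finset {a // a ∈ 𝒢.pareto} := Finset.univ.filter fun c => 𝒢.neighborGraph.Reachable a c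
  have haR : a ∈ R := by simp [R]
  have hbR : b ∈ Rᶜ := by simp [R, hreach]
  let φ : ℝ → ℝ := fun t => R.inf' ⟨a, haR⟩ fun c => 𝒢.loss c ⬝ᵥ w t
  let ψ : ℝ → ℝ := fun t => Rᶜ.inf' ⟨b, hbR⟩ fun c => 𝒢.loss c ⬝ᵥ w t
  have hφ : Continuous φ := Continuous.finset_inf'_apply _ fun c _ => hwc _
  have hψ : Continuous ψ := Continuous.finset_inf'_apply _ fun c _ => hwc _
  have hab : ∀ c ∈ Rᶜ, (c : Fin k) ≠ a := fun c hc h => by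
    rw [Subtype.ext h] at hc
    exact (Finset.mem_compl.1 hc) haR
  have hba : ∀ c ∈ R, (c : Fin k) ≠ b := fun c hc h => by
    rw [Subtype.ext h] at hc
    exact (Finset.mem_compl.1 hbR) hc
  have h0 : φ 0 - ψ 0 ≤ 0 := by
    obtain ⟨c, hc, hce⟩ := Finset.exists_mem_eq_inf' ⟨b, hbR⟩ fun c => 𝒢.loss c ⬝ᵥ w 0
    have h1 : φ 0 ≤ 𝒢.loss a ⬝ᵥ w 0 := Finset.inf'_le _ haR
    have h2 := hua ⟨c, hab c hc⟩
    have h3 : ψ 0 = _ := hce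
    simp only [sub_dotProduct, w, sub_zero, one_smul, zero_smul, add_zero] at h1 h2 h3
    linarith
  have h1 : 0 ≤ φ 1 - ψ 1 := by
    obtain ⟨c, hc, hce⟩ := Finset.exists_mem_eq_inf' ⟨a, haR⟩ fun c => 𝒢.loss c ⬝ᵥ w 1
    have h1 : ψ 1 ≤ 𝒢.loss b ⬝ᵥ w 1 := Finset.inf'_le _ hbR
    have h2 := hvb ⟨c, hba c hc⟩
    have h3 : φ 1 = _ := hce
    simp only [sub_dotProduct, w, sub_self, one_smul, zero_smul, zero_add] at h1 h2 h3
    linarith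
  obtain ⟨t, ⟨ht0, ht1⟩, ht⟩ := intermediate_value_Icc (zero_le_one (α := ℝ))
    (hφ.sub hψ).continuousOn ⟨h0, h1⟩
  have hwt : w t ∈ openSimplex d := by
    rcases ht0.eq_or_lt with rfl | ht0
    · simpa [w] using hu
    · exact openSimplex_segment (openSimplex_subset hu) hv ht0 ht1
  obtain ⟨c, hc, hce⟩ := Finset.exists_mem_eq_inf' ⟨a, haR⟩ fun c => 𝒢.loss c ⬝ᵥ w t
  obtain ⟨e, he, hee⟩ := Finset.exists_mem_eq_inf' ⟨b, hbR⟩ fun c => 𝒢.loss c ⬝ᵥ w t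
  have hφc : φ t = 𝒢.loss c ⬝ᵥ w t := hce
  have hψe : ψ t = 𝒢.loss e ⬝ᵥ w t := hee
  have hcR : 𝒢.neighborGraph.Reachable a c := by simpa [R] using hc
  have heR : ¬ 𝒢.neighborGraph.Reachable a e := by simpa [R] using he
  have hcne : c ≠ e := fun h => heR (h ▸ hcR)
  have heq : 𝒢.loss c ⬝ᵥ w t = 𝒢.loss e ⬝ᵥ w t := by
    have : φ t - ψ t = 0 := ht
    linarith
  refine heR (hcR.trans (𝒢.neighbors_of_tie hk hd hdup hcne hwt heq ?_).reachable)
  intro f hf hfc hfe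
  refine lt_of_le_of_ne ?_ fun hcf => ?_
  · by_cases hfR : (⟨f, hf⟩ : {a // a ∈ 𝒢.pareto}) ∈ R
    · rw [← hφc]
      exact Finset.inf'_le (fun c : {a // a ∈ 𝒢.pareto} => 𝒢.loss c ⬝ᵥ w t) hfR
    · rw [heq, ← hψe]
      exact Finset.inf'_le (fun c : {a // a ∈ 𝒢.pareto} => 𝒢.loss c ⬝ᵥ w t)
        (Finset.mem_compl.2 hfR)
  · refine hvn ⟨(c, e, ⟨f, hf⟩), hcne, fun h => hfc (congrArg Subtype.val h).symm,
      fun h => hfe (congrArg Subtype.val h).symm⟩ ?_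
    · simp only [w, dotProduct_segment] at heq hcf
      simp only [sub_dotProduct, smul_dotProduct, smul_eq_mul]
      set A := 𝒢.loss c ⬝ᵥ u - 𝒢.loss e ⬝ᵥ u with hA
      set A' := 𝒢.loss c ⬝ᵥ v - 𝒢.loss e ⬝ᵥ v with hA'
      set F := 𝒢.loss c ⬝ᵥ u - 𝒢.loss f ⬝ᵥ u with hF
      set F' := 𝒢.loss c ⬝ᵥ v - 𝒢.loss f ⬝ᵥ v with hF'
      have e1 : (1 - t) * A + t * A' = 0 := by rw [hA, hA']; linarith
      have e2 : (1 - t) * F + t * F' = 0 := by rw [hF, hF']; linarith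
      -- A triple tie makes `(1 - t, t)` a null vector of the matrix with rows `(A, A')`, `(F, F')`;
      -- since `t` and `1 - t` sum to one, the determinant is zero.
      have e3 : t * (A * F' - F * A') = 0 := by linear_combination A * e2 - F * e1
      have e4 : (1 - t) * (A * F' - F * A') = 0 := by linear_combination F' * e1 - A' * e2
      linear_combination e3 + e4

/-! ### Estimators -/

theorem exists_isPathEstimator (𝒢 : PMGame k d S) (hk : 0 < k) (hd : 0 < d)
    (hdup : 𝒢.NoDuplicates) (hobs : 𝒢.GloballyObservable) : ∃ G, 𝒢.IsPathEstimator G := by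
  classical
  obtain ⟨τ, hτ, htree⟩ := (𝒢.neighborGraph_connected hk hd hdup).exists_isTree_le
  obtain ⟨a₀, ha₀⟩ := 𝒢.pareto_nonempty hk hd hdup
  have hw : ∀ a b : Fin k, ∃ v : Fin k → S → ℝ, ∀ (ha : a ∈ 𝒢.pareto) (hb : b ∈ 𝒢.pareto),
      τ.Adj ⟨a, ha⟩ ⟨b, hb⟩ → 𝒢.Recovers a b v := fun a b => by
    by_cases h : ∃ (ha : a ∈ 𝒢.pareto) (hb : b ∈ 𝒢.pareto), τ.Adj ⟨a, ha⟩ ⟨b, hb⟩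
    · obtain ⟨ha, hb, hab⟩ := h
      obtain ⟨v, hv⟩ := hobs _ _ (hτ hab)
      exact ⟨v, fun _ _ _ => hv⟩
    · exact ⟨0, fun ha hb hab => (h ⟨ha, hb, hab⟩).elim⟩
  choose w hw using hw
  have hp : ∀ b, ∃ p : τ.Walk b ⟨a₀, ha₀⟩, p.IsPath := fun b =>
    (htree.connected b ⟨a₀, ha₀⟩).exists_isPath
  choose p hp using hp
  refine ⟨fun a σ b => if hb : b ∈ 𝒢.pareto then
    ((p ⟨b, hb⟩).darts.map fun e => w e.fst e.snd a σ).sum else 0, τ, ⟨a₀, ha₀⟩, w, hτ, htree,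
    fun a b hab => hw a b a.2 b.2 hab, fun b => ⟨p b, hp b, fun a σ => ?_⟩, fun b hb a σ => ?_⟩
  · simp
  · simp [hb]

theorem sum_walk_darts (𝒢 : PMGame k d S) {τ : SimpleGraph {a // a ∈ 𝒢.pareto}}
    {w : Fin k → Fin k → Fin k → S → ℝ} (hw : ∀ a b, τ.Adj a b → 𝒢.Recovers a b (w a b))
    {a b : {a // a ∈ 𝒢.pareto}} (p : τ.Walk a b) (x : Fin d) :
    ∑ c, (p.darts.map fun e => w e.fst e.snd c (𝒢.feedback c x)).sum =
      𝒢.loss a x - 𝒢.loss b x := by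
  induction p with
  | nil => simp
  | cons h p ih =>
    simp only [SimpleGraph.Walk.darts_cons, List.map_cons, List.sum_cons, Finset.sum_add_distrib,
      ih, hw _ _ h x]
    ring

/-- Path estimators estimate losses relative to the root without bias. -/
theorem IsPathEstimator.exists_root {𝒢 : PMGame k d S} {G : Fin k → S → Fin k → ℝ}
    (hG : 𝒢.IsPathEstimator G) : ∃ root : Fin k, ∀ b ∈ 𝒢.pareto, ∀ x,
      ∑ c, G c (𝒢.feedback c x) b = 𝒢.loss b x - 𝒢.loss root x := by
  obtain ⟨τ, root, w, -, -, hw, hp, -⟩ := hG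
  refine ⟨root, fun b hb x => ?_⟩
  obtain ⟨p, -, hp⟩ := hp ⟨b, hb⟩
  have := 𝒢.sum_walk_darts hw p x
  simp only [← hp] at this
  exact this

/-! ### Expectations -/

section Expect

variable (𝒢 : PMGame k d S) {p : List (Fin k × S) → Fin k → ℝ}
  {ν : List (Fin k × Fin d) → Fin d → ℝ}

theorem expect_mono (hp : IsLearner p) (hν : IsOpponent ν) {f g : List (Fin k × Fin d) → ℝ}
    (n : ℕ) (h : List (Fin k × Fin d)) (hfg : ∀ h', h'.length = n + h.length → f h' ≤ g h') :
    𝒢.expect p ν f n h ≤ 𝒢.expect p ν g n h := by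
  induction n generalizing h with
  | zero => exact hfg h (by simp)
  | succ n ih =>
    simp only [expect]
    refine Finset.sum_le_sum fun x _ => mul_le_mul_of_nonneg_left
      (Finset.sum_le_sum fun a _ => mul_le_mul_of_nonneg_left (ih _ fun h' hh' => hfg h' ?_)
        ((hp _).1 a)) ((hν h).1 x)
    rw [hh', List.length_cons]
    omega

theorem expect_add (f g : List (Fin k × Fin d) → ℝ) (n : ℕ) (h : List (Fin k × Fin d)) :
    𝒢.expect p ν (fun h => f h + g h) n h = 𝒢.expect p ν f n h + 𝒢.expect p ν g n h := by
  induction n generalizing h with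
  | zero => rfl
  | succ n ih => simp only [expect, ih, mul_add, Finset.sum_add_distrib]

theorem expect_mul (c : ℝ) (f : List (Fin k × Fin d) → ℝ) (n : ℕ) (h : List (Fin k × Fin d)) :
    𝒢.expect p ν (fun h => c * f h) n h = c * 𝒢.expect p ν f n h := by
  induction n generalizing h with
  | zero => rfl
  | succ n ih =>
    simp only [expect, ih, Finset.mul_sum]
    exact Finset.sum_congr rfl fun x _ => Finset.sum_congr rfl fun a _ => by ring

theorem expect_const (hp : IsLearner p) (hν : IsOpponent ν) (c : ℝ) (n : ℕ)
    (h : List (Fin k × Fin d)) : 𝒢.expect p ν (fun _ => c) n h = c := by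
  induction n generalizing h with
  | zero => rfl
  | succ n ih => simp only [expect, ih, ← Finset.sum_mul, (hp _).2, (hν _).2, one_mul]

theorem expect_finset_sum {ι : Type*} (I : Finset ι) (f : ι → List (Fin k × Fin d) → ℝ) (n : ℕ)
    (h : List (Fin k × Fin d)) :
    𝒢.expect p ν (fun h => ∑ i ∈ I, f i h) n h = ∑ i ∈ I, 𝒢.expect p ν (f i) n h := by
  classical
  induction I using Finset.induction_on with
  | empty => simpa using 𝒢.expect_mul (p := p) (ν := ν) 0 (fun _ => 0) n h
  | insert i I hi ih => simp only [Finset.sum_insert hi, expect_add, ih]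

/-- The expectation of a supermartingale is at most its initial value. -/
theorem expect_le_of_step (hp : IsLearner p) (hν : IsOpponent ν) {f : List (Fin k × Fin d) → ℝ}
    (hf : ∀ h x, ∑ a, p (𝒢.observed h) a * f ((a, x) :: h) ≤ f h) (n : ℕ)
    (h : List (Fin k × Fin d)) : 𝒢.expect p ν f n h ≤ f h := by
  induction n generalizing h with
  | zero => exact le_rfl
  | succ n ih =>
    simp only [expect]
    calc _ ≤ ∑ x, ν h x * f h := Finset.sum_le_sum fun x _ => mul_le_mul_of_nonneg_left
          ((Finset.sum_le_sum fun a _ => mul_le_mul_of_nonneg_left (ih _) ((hp _).1 a)).trans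
            (hf h x)) ((hν h).1 x)
      _ = f h := by rw [← Finset.sum_mul, (hν h).2, one_mul]

/-- Every action is outperformed by a Pareto optimal one. -/
theorem exists_pareto_expect_le (hk : 0 < k) (hd : 0 < d) (hdup : 𝒢.NoDuplicates)
    (hp : IsLearner p) (hν : IsOpponent ν) {T : ℕ} (hT : 0 < T) (a : Fin k) :
    ∃ b ∈ 𝒢.pareto,
      𝒢.expect p ν (fun h => (h.map fun r => 𝒢.loss r.1 r.2 - 𝒢.loss a r.2).sum) T [] ≤
      𝒢.expect p ν (fun h => (h.map fun r => 𝒢.loss r.1 r.2 - 𝒢.loss b r.2).sum) T [] := by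
  classical
  -- The comparator enters the expected regret only through the expected counts of the outcomes.
  -- Divided by `T` they form a point of the simplex, and the action sought is a Pareto optimal one
  -- whose cell contains it.
  let N : Fin d → List (Fin k × Fin d) → ℝ := fun x h =>
    (h.map fun r => if r.2 = x then (1 : ℝ) else 0).sum
  have hN0 : ∀ x h, 0 ≤ N x h := fun x h => List.sum_nonneg (by
    intro y hy
    obtain ⟨r, -, rfl⟩ := List.mem_map.1 hy
    split_ifs <;> norm_num)
  have hNsum : ∀ h, ∑ x, N x h = h.length := fun h => by
    induction h with
    | nil => simp [N]
    | cons r h ih =>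
      have : ∀ x, N x (r :: h) = (if r.2 = x then 1 else 0) + N x h := fun x => by simp [N]
      simp only [this, Finset.sum_add_distrib, ih]
      simp [add_comm]
  have hsplit : ∀ c h, (h.map fun r => 𝒢.loss r.1 r.2 - 𝒢.loss c r.2).sum =
      (h.map fun r => 𝒢.loss r.1 r.2).sum + ∑ x, (-𝒢.loss c x) * N x h := fun c h => by
    induction h with
    | nil => simp [N]
    | cons r h ih =>
      have : ∀ x, N x (r :: h) = (if r.2 = x then 1 else 0) + N x h := fun x => by simp [N]
      simp only [this, List.map_cons, List.sum_cons, ih, mul_add, Finset.sum_add_distrib]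
      simp
      ring
  have hE : ∀ c, 𝒢.expect p ν (fun h => (h.map fun r => 𝒢.loss r.1 r.2 - 𝒢.loss c r.2).sum) T [] =
      𝒢.expect p ν (fun h => (h.map fun r => 𝒢.loss r.1 r.2).sum) T [] -
        ∑ x, 𝒢.loss c x * 𝒢.expect p ν (N x) T [] := fun c => by
    simp only [hsplit, expect_add, expect_finset_sum, expect_mul]
    simp [sub_eq_add_neg]
  have hT' : (0 : ℝ) < T := Nat.cast_pos.2 hT
  have hu : (fun x => 𝒢.expect p ν (N x) T [] / T) ∈ stdSimplex ℝ (Fin d) := by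
    refine ⟨fun x => div_nonneg ?_ hT'.le, ?_⟩
    · have := 𝒢.expect_mono hp hν (f := fun _ => 0) (g := N x) T [] fun h _ => hN0 x h
      rwa [𝒢.expect_const hp hν] at this
    · rw [← Finset.sum_div, ← expect_finset_sum, div_eq_one_iff_eq hT'.ne']
      refine le_antisymm ?_ ?_
      · refine (𝒢.expect_mono hp hν (g := fun _ => (T : ℝ)) T [] fun h hh => ?_).trans_eq
          (𝒢.expect_const hp hν _ _ _)
        rw [hNsum, hh]
        simp
      · refine (𝒢.expect_const hp hν (T : ℝ) T []).symm.trans_le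
          (𝒢.expect_mono hp hν T [] fun h hh => ?_)
        rw [hNsum, hh]
        simp
  obtain ⟨b, hb, hub⟩ := 𝒢.exists_mem_pareto_cell hk hd hdup hu
  refine ⟨b, hb, ?_⟩
  have := ((𝒢.mem_cell_iff b _).1 hub).2 a
  simp only [dotProduct, mul_div_assoc', ← Finset.sum_div] at this
  rw [div_le_div_iff_of_pos_right hT'] at this
  rw [hE, hE]
  linarith

end Expect

/-! ### Exponential weights -/

/-- The partition function of the exponential weights. -/
noncomputable def partition (𝒢 : PMGame k d S) (Y : Fin k → ℝ) (β : ℝ) : ℝ :=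
  ∑ b ∈ 𝒢.pareto, Real.exp (-(1 / β) * Y b)

/-- The free energy `-β log ∑ exp (-Y_b / β)`. -/
noncomputable def freeEnergy (𝒢 : PMGame k d S) (Y : Fin k → ℝ) (β : ℝ) : ℝ :=
  -β * Real.log (𝒢.partition Y β)

section Weights

variable (𝒢 : PMGame k d S) (Y : Fin k → ℝ) (β : ℝ)

theorem partition_pos (hne : 𝒢.pareto.Nonempty) : 0 < 𝒢.partition Y β :=
  Finset.sum_pos (fun _ _ => Real.exp_pos _) hne

theorem expWeights_of_mem {a : Fin k} (ha : a ∈ 𝒢.pareto) :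
    𝒢.expWeights Y β a = Real.exp (-(1 / β) * Y a) / 𝒢.partition Y β := by
  rw [expWeights, if_pos ha]
  rfl

theorem expWeights_of_notMem {a : Fin k} (ha : a ∉ 𝒢.pareto) : 𝒢.expWeights Y β a = 0 := by
  rw [expWeights, if_neg ha]

theorem expWeights_pos (hne : 𝒢.pareto.Nonempty) {a : Fin k} (ha : a ∈ 𝒢.pareto) :
    0 < 𝒢.expWeights Y β a := by
  rw [expWeights_of_mem 𝒢 Y β ha]
  exact div_pos (Real.exp_pos _) (𝒢.partition_pos Y β hne)

theorem expWeights_nonneg (hne : 𝒢.pareto.Nonempty) (a : Fin k) : 0 ≤ 𝒢.expWeights Y β a := by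
  by_cases ha : a ∈ 𝒢.pareto
  · exact (𝒢.expWeights_pos Y β hne ha).le
  · rw [expWeights_of_notMem 𝒢 Y β ha]

theorem sum_pareto_expWeights (hne : 𝒢.pareto.Nonempty) :
    ∑ a ∈ 𝒢.pareto, 𝒢.expWeights Y β a = 1 := by
  rw [Finset.sum_congr rfl fun a ha => 𝒢.expWeights_of_mem Y β ha, ← Finset.sum_div]
  exact div_self (𝒢.partition_pos Y β hne).ne'

theorem sum_expWeights_mul (f : Fin k → ℝ) :
    ∑ a, 𝒢.expWeights Y β a * f a = ∑ a ∈ 𝒢.pareto, 𝒢.expWeights Y β a * f a :=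
  (Finset.sum_subset (Finset.subset_univ _) fun a _ ha => by
    rw [expWeights_of_notMem 𝒢 Y β ha, zero_mul]).symm

theorem sum_expWeights (hne : 𝒢.pareto.Nonempty) : ∑ a, 𝒢.expWeights Y β a = 1 := by
  have := 𝒢.sum_expWeights_mul Y β fun _ => 1
  simp only [mul_one] at this
  rw [this, sum_pareto_expWeights 𝒢 Y β hne]

theorem log_expWeights (hne : 𝒢.pareto.Nonempty) {a : Fin k} (ha : a ∈ 𝒢.pareto) :
    Real.log (𝒢.expWeights Y β a) = -(1 / β) * Y a - Real.log (𝒢.partition Y β) := by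
  rw [expWeights_of_mem 𝒢 Y β ha, Real.log_div (Real.exp_ne_zero _)
    (𝒢.partition_pos Y β hne).ne', Real.log_exp]

/-- Gibbs' inequality. -/
theorem sum_mul_log_le {ι : Type*} {I : Finset ι} {q r : ι → ℝ} (hq : ∀ i ∈ I, 0 < q i)
    (hr : ∀ i ∈ I, 0 < r i) (hqs : ∑ i ∈ I, q i = 1) (hrs : ∑ i ∈ I, r i = 1) :
    ∑ i ∈ I, q i * Real.log (r i) ≤ ∑ i ∈ I, q i * Real.log (q i) := by
  rw [← sub_nonpos, ← Finset.sum_sub_distrib]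
  calc _ ≤ ∑ i ∈ I, (r i - q i) := Finset.sum_le_sum fun i hi => by
        rw [← mul_sub, ← Real.log_div (hr i hi).ne' (hq i hi).ne']
        have := mul_le_mul_of_nonneg_left
          (Real.log_le_sub_one_of_pos (div_pos (hr i hi) (hq i hi))) (hq i hi).le
        rwa [mul_sub, mul_div_cancel₀ _ (hq i hi).ne', mul_one] at this
    _ = 0 := by rw [Finset.sum_sub_distrib, hqs, hrs, sub_self]

theorem sum_expWeights_mul_log (hne : 𝒢.pareto.Nonempty) {q : Fin k → ℝ}
    (hq : ∑ a ∈ 𝒢.pareto, q a = 1) :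
    ∑ a ∈ 𝒢.pareto, q a * Real.log (𝒢.expWeights Y β a) =
      -(1 / β) * ∑ a ∈ 𝒢.pareto, q a * Y a - Real.log (𝒢.partition Y β) := by
  rw [Finset.sum_congr rfl fun a ha => by rw [𝒢.log_expWeights Y β hne ha, mul_sub],
    Finset.sum_sub_distrib, ← Finset.sum_mul, hq, one_mul, Finset.mul_sum]
  congr 1
  exact Finset.sum_congr rfl fun a _ => by ring

/-- Changing the learning rate changes the free energy by at most an entropy term. -/
theorem freeEnergy_le (hne : 𝒢.pareto.Nonempty) {β β' : ℝ} (hβ : 0 < β) (hβ' : 0 < β') :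
    𝒢.freeEnergy Y β ≤
      𝒢.freeEnergy Y β' + (β' - β) * 𝒢.entropy (𝒢.expWeights Y β') := by
  have hs := 𝒢.sum_pareto_expWeights Y β' hne
  have h1 := 𝒢.sum_expWeights_mul_log Y β' hne hs
  have h2 := 𝒢.sum_expWeights_mul_log Y β hne hs
  -- The free energy is the minimum over `q` of `⟨q, Y⟩ - β H(q)`. Gibbs' inequality bounds it by
  -- the value at the minimizer for `β'`.
  have h3 := sum_mul_log_le (fun a ha => 𝒢.expWeights_pos Y β' hne ha)
    (fun a ha => 𝒢.expWeights_pos Y β hne ha) hs (𝒢.sum_pareto_expWeights Y β hne)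
  rw [h2] at h3
  unfold freeEnergy entropy
  set P := ∑ a ∈ 𝒢.pareto, 𝒢.expWeights Y β' a * Y a
  set E := ∑ a ∈ 𝒢.pareto, 𝒢.expWeights Y β' a * Real.log (𝒢.expWeights Y β' a)
  have h4 := mul_le_mul_of_nonneg_left h3 hβ.le
  have h5 : β * (-(1 / β) * P - Real.log (𝒢.partition Y β)) =
      -P - β * Real.log (𝒢.partition Y β) := by field_simp
  have h6 : β' * E = -P - β' * Real.log (𝒢.partition Y β') := by rw [h1]; field_simp
  linarith

theorem freeEnergy_le_apply {β : ℝ} (hβ : 0 < β) {a : Fin k} (ha : a ∈ 𝒢.pareto) :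
    𝒢.freeEnergy Y β ≤ Y a := by
  have h1 : Real.exp (-(1 / β) * Y a) ≤ 𝒢.partition Y β :=
    Finset.single_le_sum (f := fun b => Real.exp (-(1 / β) * Y b))
      (fun _ _ => (Real.exp_pos _).le) ha
  have h2 := Real.log_le_log (Real.exp_pos _) h1
  rw [Real.log_exp] at h2
  have h3 := mul_le_mul_of_nonneg_left h2 hβ.le
  have h4 : β * (-(1 / β) * Y a) = -Y a := by field_simp
  unfold freeEnergy
  linarith

theorem freeEnergy_zero : 𝒢.freeEnergy 0 β = -β * Real.log 𝒢.pareto.card := by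
  simp [freeEnergy, partition]

theorem freeEnergy_add (hne : 𝒢.pareto.Nonempty) (y : Fin k → ℝ) :
    𝒢.freeEnergy (fun b => Y b + y b) β = 𝒢.freeEnergy Y β -
      β * Real.log (∑ b ∈ 𝒢.pareto, 𝒢.expWeights Y β b * Real.exp (-(1 / β) * y b)) := by
  have h1 : 𝒢.partition (fun b => Y b + y b) β = 𝒢.partition Y β *
      ∑ b ∈ 𝒢.pareto, 𝒢.expWeights Y β b * Real.exp (-(1 / β) * y b) := by
    rw [Finset.mul_sum]
    refine Finset.sum_congr rfl fun b hb => ?_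
    rw [𝒢.expWeights_of_mem Y β hb, mul_add, Real.exp_add]
    have := (𝒢.partition_pos Y β hne).ne'
    field_simp
  have h2 : 0 < ∑ b ∈ 𝒢.pareto, 𝒢.expWeights Y β b * Real.exp (-(1 / β) * y b) :=
    Finset.sum_pos (fun b hb => mul_pos (𝒢.expWeights_pos Y β hne hb) (Real.exp_pos _)) hne
  rw [freeEnergy, h1, Real.log_mul (𝒢.partition_pos Y β hne).ne' h2.ne', freeEnergy]
  ring

end Weights

/-- The range 4 is what the exploration guarantees for centred, scaled estimates, and `81 = 3⁴`
exceeds `exp 4`. -/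
theorem exp_le_quadratic {x : ℝ} (hx : x ≤ 4) : Real.exp x ≤ 1 + x + 81 * x ^ 2 := by
  rcases le_total |x| 1 with h | h
  · have h1 := (abs_le.1 (Real.abs_exp_sub_one_sub_id_le h)).2
    nlinarith [sq_nonneg x]
  · have h2 : Real.exp 4 ≤ 81 := by
      have : Real.exp 4 = Real.exp 1 ^ 4 := by rw [← Real.exp_nat_mul]; norm_num
      rw [this]
      calc Real.exp 1 ^ 4 ≤ 3 ^ 4 :=
            pow_le_pow_left₀ (Real.exp_pos 1).le (by linarith [Real.exp_one_lt_d9]) 4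
        _ = 81 := by norm_num
    rcases le_abs.1 h with h | h
    · have h1 := Real.exp_le_exp.2 hx
      nlinarith
    · have h1 : Real.exp x ≤ 1 := Real.exp_le_one_iff.2 (by linarith)
      nlinarith

/-- The stability of exponential weights, centred at the coordinate `m`. -/
theorem log_sum_exp_le {ι : Type*} {I : Finset ι} {q z : ι → ℝ} (hq : ∀ i ∈ I, 0 ≤ q i)
    (hqs : ∑ i ∈ I, q i = 1) {m : ι} (hm : m ∈ I) {D : ℝ} (hD : D ≤ 4)
    (hz : ∀ i ∈ I, |z i - z m| ≤ D) :
    Real.log (∑ i ∈ I, q i * Real.exp (-z i)) ≤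
      -∑ i ∈ I, q i * z i + 81 * (1 - q m) * D ^ 2 := by
  classical
  -- After factoring out `exp (-z m)` the summand at `m` has no quadratic error, so the error
  -- carries the weight `1 - q m`, which is `b_t` when `m` is the mode.
  have h1 : ∑ i ∈ I, q i * Real.exp (-z i) =
      Real.exp (-z m) * ∑ i ∈ I, q i * Real.exp (z m - z i) := by
    rw [Finset.mul_sum]
    refine Finset.sum_congr rfl fun i _ => ?_
    rw [mul_left_comm, ← Real.exp_add]
    ring_nf
  have h2 : ∑ i ∈ I, q i * Real.exp (z m - z i) ≤
      ∑ i ∈ I, (q i * (1 + (z m - z i)) + 81 * D ^ 2 * (if i = m then 0 else q i)) := by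
    refine Finset.sum_le_sum fun i hi => ?_
    split_ifs with him
    · simp [him]
    · have h3 := abs_le.1 (hz i hi)
      have h4 := exp_le_quadratic (x := z m - z i) (by linarith)
      have h5 : (z m - z i) ^ 2 ≤ D ^ 2 := sq_le_sq' (by linarith) (by linarith)
      nlinarith [mul_le_mul_of_nonneg_left (h4.trans (by linarith :
        _ ≤ 1 + (z m - z i) + 81 * D ^ 2)) (hq i hi)]
  have h3 : ∑ i ∈ I, (if i = m then 0 else q i) = 1 - q m := by
    rw [← hqs, ← Finset.add_sum_erase I q hm, add_sub_cancel_left,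
      ← Finset.add_sum_erase I _ hm, if_pos rfl, zero_add]
    exact Finset.sum_congr rfl fun i hi => if_neg (Finset.ne_of_mem_erase hi)
  have h4 : ∑ i ∈ I, q i * (1 + (z m - z i)) = 1 + z m - ∑ i ∈ I, q i * z i := by
    have : ∀ i, q i * (1 + (z m - z i)) = q i * (1 + z m) - q i * z i := fun i => by ring
    simp only [this, Finset.sum_sub_distrib, ← Finset.sum_mul, hqs, one_mul]
  rw [Finset.sum_add_distrib, ← Finset.mul_sum, h3, h4] at h2
  have hpos : 0 < ∑ i ∈ I, q i * Real.exp (z m - z i) := by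
    refine lt_of_le_of_ne (Finset.sum_nonneg fun i hi =>
      mul_nonneg (hq i hi) (Real.exp_pos _).le) fun h0 => ?_
    have h5 := (Finset.sum_eq_zero_iff_of_nonneg fun i hi =>
      mul_nonneg (hq i hi) (Real.exp_pos (z m - z i)).le).1 h0.symm
    have h6 : ∑ i ∈ I, q i = 0 := Finset.sum_eq_zero fun i hi =>
      (mul_eq_zero.1 (h5 i hi)).resolve_right (Real.exp_ne_zero _)
    linarith
  rw [h1, Real.log_mul (Real.exp_ne_zero _) hpos.ne', Real.log_exp]
  have := Real.log_le_sub_one_of_pos hpos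
  linarith

/-! ### The quantities `b_t` and `a_t` -/

theorem exists_bOf_eq (𝒢 : PMGame k d S) (hne : 𝒢.pareto.Nonempty) (q : Fin k → ℝ) :
    ∃ m ∈ 𝒢.pareto, 𝒢.bOf q = 1 - q m ∧ ∀ a ∈ 𝒢.pareto, q a ≤ q m := by
  obtain ⟨m, hm, hmax⟩ := Finset.exists_max_image 𝒢.pareto q hne
  have : Nonempty {a // a ∈ 𝒢.pareto} := ⟨⟨m, hm⟩⟩
  refine ⟨m, hm, ?_, hmax⟩
  rw [bOf]
  congr 1
  exact le_antisymm (ciSup_le fun a => hmax a a.2)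
    (le_ciSup (f := fun a : {a // a ∈ 𝒢.pareto} => q a) (Set.finite_range _).bddAbove ⟨m, hm⟩)

section Entropy

variable (𝒢 : PMGame k d S) {q : Fin k → ℝ}

theorem le_one_of_mem (hq : ∀ a ∈ 𝒢.pareto, 0 < q a) (hqs : ∑ a ∈ 𝒢.pareto, q a = 1) {a : Fin k}
    (ha : a ∈ 𝒢.pareto) : q a ≤ 1 :=
  hqs ▸ Finset.single_le_sum (fun b hb => (hq b hb).le) ha

theorem bOf_nonneg (hne : 𝒢.pareto.Nonempty) (hq : ∀ a ∈ 𝒢.pareto, 0 < q a)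
    (hqs : ∑ a ∈ 𝒢.pareto, q a = 1) : 0 ≤ 𝒢.bOf q := by
  obtain ⟨m, hm, hb, -⟩ := 𝒢.exists_bOf_eq hne q
  have := 𝒢.le_one_of_mem hq hqs hm
  linarith

theorem bOf_le_one (hne : 𝒢.pareto.Nonempty) (hq : ∀ a ∈ 𝒢.pareto, 0 < q a) : 𝒢.bOf q ≤ 1 := by
  obtain ⟨m, hm, hb, -⟩ := 𝒢.exists_bOf_eq hne q
  have := hq m hm
  linarith

/-- Average `-log (q a) ≥ 1 - q a ≥ 1 - max q` with respect to `q`. -/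
theorem bOf_le_entropy (hne : 𝒢.pareto.Nonempty) (hq : ∀ a ∈ 𝒢.pareto, 0 < q a)
    (hqs : ∑ a ∈ 𝒢.pareto, q a = 1) : 𝒢.bOf q ≤ 𝒢.entropy q := by
  obtain ⟨m, hm, hb, hmax⟩ := 𝒢.exists_bOf_eq hne q
  have h1 : ∑ a ∈ 𝒢.pareto, q a * Real.log (q a) ≤ ∑ a ∈ 𝒢.pareto, q a * (q m - 1) :=
    Finset.sum_le_sum fun a ha => mul_le_mul_of_nonneg_left
      ((Real.log_le_sub_one_of_pos (hq a ha)).trans (by linarith [hmax a ha])) (hq a ha).le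
  rw [← Finset.sum_mul, hqs] at h1
  rw [hb, entropy]
  linarith

theorem entropy_le_log_card (hne : 𝒢.pareto.Nonempty) (hq : ∀ a ∈ 𝒢.pareto, 0 < q a)
    (hqs : ∑ a ∈ 𝒢.pareto, q a = 1) : 𝒢.entropy q ≤ Real.log 𝒢.pareto.card := by
  have hc : (0 : ℝ) < 𝒢.pareto.card := Nat.cast_pos.2 hne.card_pos
  have := sum_mul_log_le (r := fun _ => (𝒢.pareto.card : ℝ)⁻¹) hq (fun _ _ => inv_pos.2 hc) hqs
    (by rw [Finset.sum_const, nsmul_eq_mul, mul_inv_cancel₀ hc.ne'])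
  rw [← Finset.sum_mul, hqs, Real.log_inv] at this
  rw [entropy]
  linarith

/-- The largest weight contributes at most `b`. For the others, `log x ≥ 1 - 1/x` at `x = q a * (k_Π
T)` gives a logarithm plus `1 / (k_Π T)`; these remainders add up to at most `1 / T`, harmless over
`T` rounds. -/
theorem entropy_le (hne : 𝒢.pareto.Nonempty) (hq : ∀ a ∈ 𝒢.pareto, 0 < q a)
    (hqs : ∑ a ∈ 𝒢.pareto, q a = 1) {T : ℝ} (hT : 0 < T) :
    𝒢.entropy q ≤ 𝒢.bOf q * (1 + Real.log (𝒢.pareto.card * T)) + 1 / T := by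
  obtain ⟨m, hm, hb, hmax⟩ := 𝒢.exists_bOf_eq hne q
  have hc : (0 : ℝ) < 𝒢.pareto.card := Nat.cast_pos.2 hne.card_pos
  have hcT := mul_pos hc hT
  have h1 : -(q m * Real.log (q m)) ≤ 1 - q m := by
    have h := Real.one_sub_inv_le_log_of_pos (hq m hm)
    have h' := mul_le_mul_of_nonneg_left h (hq m hm).le
    rw [mul_sub, mul_inv_cancel₀ (hq m hm).ne'] at h'
    linarith
  have h2 : ∀ a ∈ 𝒢.pareto.erase m, -(q a * Real.log (q a)) ≤
      q a * Real.log (𝒢.pareto.card * T) + 1 / (𝒢.pareto.card * T) := fun a ha => by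
    have hqa := hq a (Finset.mem_of_mem_erase ha)
    have h := Real.one_sub_inv_le_log_of_pos (mul_pos hqa hcT)
    rw [Real.log_mul hqa.ne' hcT.ne'] at h
    have h' := mul_le_mul_of_nonneg_left h hqa.le
    have h3 : q a * (1 - (q a * (𝒢.pareto.card * T))⁻¹) = q a - 1 / (𝒢.pareto.card * T) := by
      field_simp
    rw [h3] at h'
    linarith
  have h3 := Finset.sum_le_sum h2
  rw [Finset.sum_add_distrib, ← Finset.sum_mul, Finset.sum_const, nsmul_eq_mul] at h3
  have h4 : ((𝒢.pareto.erase m).card : ℝ) * (1 / (𝒢.pareto.card * T)) ≤ 1 / T := by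
    have : ((𝒢.pareto.erase m).card : ℝ) ≤ 𝒢.pareto.card :=
      Nat.cast_le.2 (Finset.card_le_card (Finset.erase_subset _ _))
    calc _ ≤ (𝒢.pareto.card : ℝ) * (1 / (𝒢.pareto.card * T)) := by gcongr
      _ = 1 / T := by field_simp
  have h5 : ∑ a ∈ 𝒢.pareto.erase m, q a = 1 - q m := by
    rw [← hqs, ← Finset.add_sum_erase _ _ hm, add_sub_cancel_left]
  rw [h5] at h3
  rw [entropy, ← Finset.sum_neg_distrib, ← Finset.add_sum_erase _ _ hm, hb]
  linarith

end Entropy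

/-! ### One round of the algorithm -/

section Round

variable (𝒢 : PMGame k d S) {c₁ : ℝ}

theorem qOf_pos (hne : 𝒢.pareto.Nonempty) (s : AlgState k) : ∀ a ∈ 𝒢.pareto, 0 < 𝒢.qOf s a :=
  fun _ ha => 𝒢.expWeights_pos _ _ hne ha

theorem qOf_nonneg (hne : 𝒢.pareto.Nonempty) (s : AlgState k) (a : Fin k) : 0 ≤ 𝒢.qOf s a :=
  𝒢.expWeights_nonneg _ _ hne a

theorem sum_qOf (hne : 𝒢.pareto.Nonempty) (s : AlgState k) : ∑ a, 𝒢.qOf s a = 1 :=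
  𝒢.sum_expWeights _ _ hne

theorem sum_pareto_qOf (hne : 𝒢.pareto.Nonempty) (s : AlgState k) :
    ∑ a ∈ 𝒢.pareto, 𝒢.qOf s a = 1 :=
  𝒢.sum_pareto_expWeights _ _ hne

theorem bOf_qOf_nonneg (hne : 𝒢.pareto.Nonempty) (s : AlgState k) : 0 ≤ 𝒢.bOf (𝒢.qOf s) :=
  𝒢.bOf_nonneg hne (𝒢.qOf_pos hne s) (𝒢.sum_pareto_qOf hne s)

theorem bOf_qOf_le_one (hne : 𝒢.pareto.Nonempty) (s : AlgState k) : 𝒢.bOf (𝒢.qOf s) ≤ 1 :=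
  𝒢.bOf_le_one hne (𝒢.qOf_pos hne s)

theorem entropy_nonneg (hne : 𝒢.pareto.Nonempty) (s : AlgState k) : 0 ≤ 𝒢.entropy (𝒢.qOf s) :=
  (𝒢.bOf_qOf_nonneg hne s).trans
    (𝒢.bOf_le_entropy hne (𝒢.qOf_pos hne s) (𝒢.sum_pareto_qOf hne s))

theorem bSum_le_bSumNext (hne : 𝒢.pareto.Nonempty) (s : AlgState k) :
    s.bSum ≤ 𝒢.bSumNext s :=
  le_add_of_nonneg_right (𝒢.bOf_qOf_nonneg hne s)

theorem four_le_bOverGammaPrime {B : ℝ} (hc₁ : 0 < c₁) (hB : 0 ≤ B) :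
    4 ≤ bOverGammaPrime c₁ B := by
  rw [bOverGammaPrime, le_div_iff₀ hc₁]
  have : 0 ≤ B ^ (1 / 3 : ℝ) := Real.rpow_nonneg hB _
  linarith

theorem bOverGammaPrime_mul_gammaPrime {b B : ℝ} (hc₁ : 0 < c₁) (hB : 0 ≤ B) :
    bOverGammaPrime c₁ B * gammaPrime c₁ b B = b := by
  have : 0 ≤ B ^ (1 / 3 : ℝ) := Real.rpow_nonneg hB _
  have : c₁ + B ^ (1 / 3 : ℝ) ≠ 0 := by positivity
  rw [bOverGammaPrime, gammaPrime]
  field_simp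

theorem gammaPrime_nonneg {b B : ℝ} (hc₁ : 0 < c₁) (hb : 0 ≤ b) (hB : 0 ≤ B) :
    0 ≤ gammaPrime c₁ b B := by
  have : 0 ≤ B ^ (1 / 3 : ℝ) := Real.rpow_nonneg hB _
  rw [gammaPrime]
  positivity

theorem gammaPrime_le {b B : ℝ} (hc₁ : 0 < c₁) (hb : 0 ≤ b) (hb1 : b ≤ 1) (hB : 0 ≤ B) :
    gammaPrime c₁ b B ≤ 1 / 4 := by
  have h1 := bOverGammaPrime_mul_gammaPrime (b := b) hc₁ hB
  have h2 := four_le_bOverGammaPrime hc₁ hB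
  have h3 := gammaPrime_nonneg hc₁ hb hB
  nlinarith

end Round

/-! ### Exploration, and the drift of the potential in a round. -/

variable [Fintype S]

theorem one_le_cG (G : Fin k → S → Fin k → ℝ) : 1 ≤ cG G := le_max_left _ _

theorem mul_norm_le_cG (G : Fin k → S → Fin k → ℝ) : k * ‖G‖ ≤ cG G := le_max_right _ _

theorem abs_apply_le_norm (G : Fin k → S → Fin k → ℝ) (a : Fin k) (σ : S) (b : Fin k) :
    |G a σ b| ≤ ‖G‖ :=
  (norm_le_pi_norm (G a σ) b).trans ((norm_le_pi_norm (G a) σ).trans (norm_le_pi_norm G a))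

/-- States in which the variables of the algorithm are in their natural ranges. -/
structure IsValid (G : Fin k → S → Fin k → ℝ) (s : AlgState k) : Prop where
  beta_ge : 2 * cG G ≤ s.beta
  bSum_nonneg : 0 ≤ s.bSum
  zSum_nonneg : 0 ≤ s.zSum

section Valid

variable (𝒢 : PMGame k d S) {G : Fin k → S → Fin k → ℝ} {c₁ c₂ : ℝ} {s : AlgState k}

theorem IsValid.beta_pos (hs : IsValid G s) : 0 < s.beta := by
  linarith [hs.beta_ge, one_le_cG G]

theorem IsValid.bSumNext_nonneg (hs : IsValid G s) (hne : 𝒢.pareto.Nonempty) :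
    0 ≤ 𝒢.bSumNext s :=
  hs.bSum_nonneg.trans (𝒢.bSum_le_bSumNext hne s)

theorem gammaPrime_le_gamma (hs : IsValid G s) :
    gammaPrime c₁ (𝒢.bOf (𝒢.qOf s)) (𝒢.bSumNext s) ≤ 𝒢.gamma G c₁ s :=
  le_add_of_nonneg_right (div_nonneg (by linarith [one_le_cG G]) (by linarith [hs.beta_pos]))

theorem div_le_gamma (hne : 𝒢.pareto.Nonempty) (hc₁ : 0 < c₁) (hs : IsValid G s) :
    cG G / (2 * s.beta) ≤ 𝒢.gamma G c₁ s :=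
  le_add_of_nonneg_left
    (gammaPrime_nonneg hc₁ (𝒢.bOf_qOf_nonneg hne s) (hs.bSumNext_nonneg 𝒢 hne))

theorem gamma_pos (hne : 𝒢.pareto.Nonempty) (hc₁ : 0 < c₁) (hs : IsValid G s) :
    0 < 𝒢.gamma G c₁ s :=
  (div_pos (by linarith [one_le_cG G]) (by linarith [hs.beta_pos])).trans_le
    (𝒢.div_le_gamma hne hc₁ hs)

theorem gamma_le (hne : 𝒢.pareto.Nonempty) (hc₁ : 0 < c₁) (hs : IsValid G s) :
    𝒢.gamma G c₁ s ≤ 1 / 2 := by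
  have h1 := gammaPrime_le hc₁ (𝒢.bOf_qOf_nonneg hne s) (𝒢.bOf_qOf_le_one hne s)
    (hs.bSumNext_nonneg 𝒢 hne)
  have h2 : cG G / (2 * s.beta) ≤ 1 / 4 := by
    rw [div_le_iff₀ (by linarith [hs.beta_pos])]
    linarith [hs.beta_ge]
  rw [gamma]
  linarith

theorem gamma_div_le_pOf (hne : 𝒢.pareto.Nonempty) (hc₁ : 0 < c₁) (hs : IsValid G s)
    (a : Fin k) : 𝒢.gamma G c₁ s / k ≤ 𝒢.pOf G c₁ s a :=
  le_add_of_nonneg_left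
    (mul_nonneg (by linarith [𝒢.gamma_le hne hc₁ hs]) (𝒢.qOf_nonneg hne s a))

theorem pOf_pos (hne : 𝒢.pareto.Nonempty) (hc₁ : 0 < c₁) (hs : IsValid G s) (a : Fin k) :
    0 < 𝒢.pOf G c₁ s a :=
  (div_pos (𝒢.gamma_pos hne hc₁ hs) (Nat.cast_pos.2 a.pos)).trans_le
    (𝒢.gamma_div_le_pOf hne hc₁ hs a)

theorem sum_pOf (hk : 0 < k) (hne : 𝒢.pareto.Nonempty) : ∑ a, 𝒢.pOf G c₁ s a = 1 := by
  have hk' : (k : ℝ) ≠ 0 := Nat.cast_ne_zero.2 hk.ne'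
  simp only [pOf, Finset.sum_add_distrib, ← Finset.mul_sum, 𝒢.sum_qOf hne]
  simp only [Finset.sum_const, Finset.card_univ, Fintype.card_fin, nsmul_eq_mul]
  field_simp
  ring

/-- Turns the `b_t / γ_t` of the stability term into `b_t / γ'_t`, the quantity that drives the
growth of `β`. -/
theorem bOf_le_mul_gamma (hne : 𝒢.pareto.Nonempty) (hc₁ : 0 < c₁) (hs : IsValid G s) :
    𝒢.bOf (𝒢.qOf s) ≤ bOverGammaPrime c₁ (𝒢.bSumNext s) * 𝒢.gamma G c₁ s := by
  have h1 := four_le_bOverGammaPrime hc₁ (hs.bSumNext_nonneg 𝒢 hne)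
  calc _ = _ := (bOverGammaPrime_mul_gammaPrime hc₁ (hs.bSumNext_nonneg 𝒢 hne)).symm
    _ ≤ _ := mul_le_mul_of_nonneg_left (𝒢.gammaPrime_le_gamma hs) (by linarith)

/-- The change of the free energy caused by one loss estimate. -/
theorem freeEnergy_sub_le (hne : 𝒢.pareto.Nonempty) (hc₁ : 0 < c₁) (hs : IsValid G s)
    (A : Fin k) (σ : S) :
    𝒢.freeEnergy s.estSum s.beta - 𝒢.freeEnergy (𝒢.estSumNext G c₁ s A σ) s.beta ≤
      -∑ b ∈ 𝒢.pareto, 𝒢.qOf s b * (G A σ b / 𝒢.pOf G c₁ s A) +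
      324 * 𝒢.bOf (𝒢.qOf s) * ‖G‖ ^ 2 / (s.beta * 𝒢.pOf G c₁ s A ^ 2) := by
  obtain ⟨m, hm, hb, -⟩ := 𝒢.exists_bOf_eq hne (𝒢.qOf s)
  have hβ := hs.beta_pos
  have hp := 𝒢.pOf_pos hne hc₁ hs A
  have hk : (0 : ℝ) < k := Nat.cast_pos.2 A.pos
  -- This is the purpose of the summand `c_𝒢 / (2β)` of `γ`: estimates divided by `β` are at most 2,
  -- so their differences are at most 4. The constant below is `324 = 81 * 2²`.
  have hpβ : ‖G‖ ≤ 2 * (𝒢.pOf G c₁ s A * s.beta) := by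
    have h1 := (div_le_div_of_nonneg_right (𝒢.div_le_gamma hne hc₁ hs) hk.le).trans
      (𝒢.gamma_div_le_pOf hne hc₁ hs A)
    rw [div_div, div_le_iff₀ (by positivity)] at h1
    have h2 := mul_norm_le_cG G
    have h3 : k * ‖G‖ ≤ k * (2 * (𝒢.pOf G c₁ s A * s.beta)) := by linarith
    exact le_of_mul_le_mul_left h3 hk
  have key := log_sum_exp_le (I := 𝒢.pareto) (q := 𝒢.qOf s)
    (z := fun b => (1 / s.beta) * (G A σ b / 𝒢.pOf G c₁ s A)) (fun b _ => 𝒢.qOf_nonneg hne s b)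
    (𝒢.sum_pareto_qOf hne s) hm (D := 2 * ‖G‖ / (𝒢.pOf G c₁ s A * s.beta))
    (by rw [div_le_iff₀ (by positivity)]; linarith)
    (fun b _ => by
      have h1 : (1 / s.beta) * (G A σ b / 𝒢.pOf G c₁ s A) -
          (1 / s.beta) * (G A σ m / 𝒢.pOf G c₁ s A) =
          (G A σ b - G A σ m) / (𝒢.pOf G c₁ s A * s.beta) := by field_simp
      rw [h1, abs_div, abs_of_pos (mul_pos hp hβ)]
      gcongr
      calc |G A σ b - G A σ m| ≤ |G A σ b| + |G A σ m| := abs_sub _ _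
        _ ≤ 2 * ‖G‖ := by linarith [abs_apply_le_norm G A σ b, abs_apply_le_norm G A σ m])
  have h1 := 𝒢.freeEnergy_add s.estSum s.beta hne fun b => G A σ b / 𝒢.pOf G c₁ s A
  have h2 : 𝒢.estSumNext G c₁ s A σ = fun b => s.estSum b + G A σ b / 𝒢.pOf G c₁ s A := rfl
  rw [h2, h1, sub_sub_cancel]
  simp only [neg_mul] at key ⊢
  refine (mul_le_mul_of_nonneg_left key hβ.le).trans_eq ?_
  have h3 : ∑ b ∈ 𝒢.pareto, 𝒢.qOf s b * (1 / s.beta * (G A σ b / 𝒢.pOf G c₁ s A)) =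
      1 / s.beta * ∑ b ∈ 𝒢.pareto, 𝒢.qOf s b * (G A σ b / 𝒢.pOf G c₁ s A) := by
    rw [Finset.mul_sum]
    exact Finset.sum_congr rfl fun b _ => by ring
  rw [h3, ← hb]
  field_simp
  ring

/-- The expected change in one round of the regret, compensated by the loss estimates. -/
theorem sum_pOf_mul_le (hne : 𝒢.pareto.Nonempty) (hG : 𝒢.IsPathEstimator G) (hc₁ : 0 < c₁)
    (hs : IsValid G s) {a : Fin k} (ha : a ∈ 𝒢.pareto) (x : Fin d) :
    ∑ A, 𝒢.pOf G c₁ s A * (𝒢.loss A x - 𝒢.loss a x +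
        (𝒢.estSumNext G c₁ s A (𝒢.feedback A x) a - s.estSum a) +
        (𝒢.freeEnergy s.estSum s.beta -
          𝒢.freeEnergy (𝒢.estSumNext G c₁ s A (𝒢.feedback A x)) s.beta)) ≤
      𝒢.gamma G c₁ s + 324 * cG G ^ 2 * bOverGammaPrime c₁ (𝒢.bSumNext s) / s.beta := by
  obtain ⟨root, hroot⟩ := hG.exists_root
  have hk : (0 : ℝ) < k := Nat.cast_pos.2 a.pos
  have hp := 𝒢.pOf_pos hne hc₁ hs
  have hβ := hs.beta_pos
  have hγ := 𝒢.gamma_pos hne hc₁ hs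
  have hb := 𝒢.bOf_qOf_nonneg hne s
  set p := 𝒢.pOf G c₁ s with hpdef
  set γ := 𝒢.gamma G c₁ s with hγdef
  set z := bOverGammaPrime c₁ (𝒢.bSumNext s)
  have hstep : ∀ A, p A * (𝒢.loss A x - 𝒢.loss a x +
        (𝒢.estSumNext G c₁ s A (𝒢.feedback A x) a - s.estSum a) +
        (𝒢.freeEnergy s.estSum s.beta -
          𝒢.freeEnergy (𝒢.estSumNext G c₁ s A (𝒢.feedback A x)) s.beta)) ≤
      p A * 𝒢.loss A x - p A * 𝒢.loss a x + G A (𝒢.feedback A x) a -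
        ∑ b ∈ 𝒢.pareto, 𝒢.qOf s b * G A (𝒢.feedback A x) b +
        324 * (𝒢.bOf (𝒢.qOf s)) * ‖G‖ ^ 2 * k / (s.beta * γ) := fun A => by
    have h1 := 𝒢.freeEnergy_sub_le hne hc₁ hs A (𝒢.feedback A x)
    have h2 : 𝒢.estSumNext G c₁ s A (𝒢.feedback A x) a - s.estSum a =
      G A (𝒢.feedback A x) a / p A := add_sub_cancel_left _ _
    rw [h2]
    refine (mul_le_mul_of_nonneg_left (add_le_add_right h1 _) (hp A).le).trans ?_
    have hpA := hp A
    have h3 : p A * (G A (𝒢.feedback A x) a / p A) = G A (𝒢.feedback A x) a :=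
      mul_div_cancel₀ _ hpA.ne'
    have h4 : p A * ∑ b ∈ 𝒢.pareto, 𝒢.qOf s b * (G A (𝒢.feedback A x) b / p A) =
        ∑ b ∈ 𝒢.pareto, 𝒢.qOf s b * G A (𝒢.feedback A x) b := by
      rw [Finset.mul_sum]
      exact Finset.sum_congr rfl fun b _ => by field_simp
    have h5 : p A * (324 * 𝒢.bOf (𝒢.qOf s) * ‖G‖ ^ 2 / (s.beta * p A ^ 2)) ≤
        324 * (𝒢.bOf (𝒢.qOf s)) * ‖G‖ ^ 2 * k / (s.beta * γ) := by
      have h6 : γ ≤ p A * k := by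
        have := 𝒢.gamma_div_le_pOf hne hc₁ hs A
        rwa [div_le_iff₀ hk] at this
      have h7 : p A * (324 * 𝒢.bOf (𝒢.qOf s) * ‖G‖ ^ 2 / (s.beta * p A ^ 2)) =
        324 * 𝒢.bOf (𝒢.qOf s) * ‖G‖ ^ 2 * k / (s.beta * (p A * k)) := by field_simp
      rw [h7]
      gcongr
    rw [← hpdef]
    linarith
  refine (Finset.sum_le_sum fun A _ => hstep A).trans ?_
  simp only [Finset.sum_add_distrib, Finset.sum_sub_distrib, ← Finset.sum_mul]
  -- The importance weights have cancelled and the estimates are unbiased, so the losses of `a` and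
  -- of the root drop out. What remains is the loss under `p` minus that under `q`, at most `γ`, and
  -- the quadratic error, where the sum over `A` supplies the second factor `k` of `(k ‖G‖)²`.
  rw [𝒢.sum_pOf (Nat.cast_pos.1 hk) hne, hroot a ha x, Finset.sum_comm]
  have h1 : ∑ b ∈ 𝒢.pareto, ∑ A, 𝒢.qOf s b * G A (𝒢.feedback A x) b =
      ∑ b, 𝒢.qOf s b * 𝒢.loss b x - 𝒢.loss root x := by
    have h2 : ∀ b ∈ 𝒢.pareto, ∑ A, 𝒢.qOf s b * G A (𝒢.feedback A x) b =
        𝒢.qOf s b * 𝒢.loss b x - 𝒢.qOf s b * 𝒢.loss root x := fun b hb => by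
      rw [← Finset.mul_sum, hroot b hb x, mul_sub]
    rw [Finset.sum_congr rfl h2, Finset.sum_sub_distrib, ← Finset.sum_mul,
      𝒢.sum_pareto_qOf hne, one_mul]
    congr 1
    exact (𝒢.sum_expWeights_mul s.estSum s.beta fun b => 𝒢.loss b x).symm
  have h2 : ∑ A, p A * 𝒢.loss A x =
      (1 - γ) * ∑ b, 𝒢.qOf s b * 𝒢.loss b x + γ * ((∑ A, 𝒢.loss A x) / k) := by
    simp only [hpdef, pOf, add_mul, Finset.sum_add_distrib, Finset.mul_sum, Finset.sum_div]
    congr 1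
    · exact Finset.sum_congr rfl fun b _ => by ring
    · exact Finset.sum_congr rfl fun b _ => by rw [← hγdef]; ring
  have h3 : (∑ A, 𝒢.loss A x) / k ≤ 1 := by
    rw [div_le_one hk]
    calc ∑ A, 𝒢.loss A x ≤ ∑ _A : Fin k, (1 : ℝ) :=
          Finset.sum_le_sum fun A _ => (𝒢.loss_mem A x).2
      _ = k := by simp
  have h4 : 0 ≤ ∑ b, 𝒢.qOf s b * 𝒢.loss b x := Finset.sum_nonneg fun b _ =>
    mul_nonneg (𝒢.qOf_nonneg hne s b) (𝒢.loss_mem b x).1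
  have h5 : ∑ _A : Fin k, 324 * (𝒢.bOf (𝒢.qOf s)) * ‖G‖ ^ 2 * k / (s.beta * γ) ≤
      324 * cG G ^ 2 * z / s.beta := by
    have h6 := 𝒢.bOf_le_mul_gamma hne hc₁ hs
    have h7 : (k * ‖G‖) ^ 2 ≤ cG G ^ 2 := pow_le_pow_left₀ (by positivity) (mul_norm_le_cG G) 2
    have h8 : ∑ _A : Fin k, 324 * (𝒢.bOf (𝒢.qOf s)) * ‖G‖ ^ 2 * k / (s.beta * γ) =
        324 * (k * ‖G‖) ^ 2 * 𝒢.bOf (𝒢.qOf s) / (s.beta * γ) := by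
      simp
      ring
    rw [h8]
    calc _ ≤ 324 * cG G ^ 2 * (z * γ) / (s.beta * γ) := by gcongr
      _ = _ := by field_simp
  rw [h1, h2]
  nlinarith [mul_nonneg hγ.le h4, mul_le_mul_of_nonneg_left h3 hγ.le]

theorem beta_le_betaNext (hc₁ : 0 < c₁) (hc₂ : 0 < c₂) (hne : 𝒢.pareto.Nonempty)
    (hs : IsValid G s) : s.beta ≤ 𝒢.betaNext c₁ c₂ s := by
  have := four_le_bOverGammaPrime hc₁ (hs.bSumNext_nonneg 𝒢 hne)
  exact le_add_of_nonneg_right (by positivity)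

theorem isValid_algState (hc₁ : 0 < c₁) (hc₂ : 0 < c₂) (hne : 𝒢.pareto.Nonempty)
    (h : List (Fin k × S)) : IsValid G (𝒢.algState G c₁ c₂ h) := by
  induction h with
  | nil => exact ⟨le_max_right _ _, le_rfl, le_rfl⟩
  | cons r h ih =>
    refine ⟨ih.beta_ge.trans (𝒢.beta_le_betaNext hc₁ hc₂ hne ih), ih.bSumNext_nonneg 𝒢 hne,
      add_nonneg ih.zSum_nonneg (mul_nonneg ?_ ?_)⟩
    · linarith [four_le_bOverGammaPrime hc₁ (ih.bSumNext_nonneg 𝒢 hne)]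
    · have hq := 𝒢.qOf_pos hne (𝒢.algState G c₁ c₂ (r :: h))
      have hqs := 𝒢.sum_pareto_qOf hne (𝒢.algState G c₁ c₂ (r :: h))
      exact (𝒢.bOf_nonneg hne hq hqs).trans (𝒢.bOf_le_entropy hne hq hqs)

theorem isLearner_algorithm (hk : 0 < k) (hc₁ : 0 < c₁) (hc₂ : 0 < c₂)
    (hne : 𝒢.pareto.Nonempty) : IsLearner (𝒢.algorithm G c₁ c₂) := fun h =>
  ⟨fun a => (𝒢.pOf_pos hne hc₁ (𝒢.isValid_algState hc₁ hc₂ hne h) a).le, 𝒢.sum_pOf hk hne⟩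

/-- The bound on the regret along a history: exploration, stability and penalty. -/
noncomputable def regretBound (𝒢 : PMGame k d S) (G : Fin k → S → Fin k → ℝ) (c₁ c₂ : ℝ) :
    List (Fin k × S) → ℝ
  | [] => 0
  | r :: h =>
    let s := 𝒢.algState G c₁ c₂ h
    let s' := 𝒢.algState G c₁ c₂ (r :: h)
    regretBound 𝒢 G c₁ c₂ h + 𝒢.gamma G c₁ s +
      324 * cG G ^ 2 * bOverGammaPrime c₁ (𝒢.bSumNext s) / s.beta +
      (s'.beta - s.beta) * 𝒢.entropy (𝒢.qOf s')

/-- The regret with respect to a Pareto optimal action. -/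
theorem expect_regret_le (hk : 0 < k) (hc₁ : 0 < c₁) (hc₂ : 0 < c₂) (hne : 𝒢.pareto.Nonempty)
    (hG : 𝒢.IsPathEstimator G) {ν : List (Fin k × Fin d) → Fin d → ℝ} (hν : IsOpponent ν)
    {a : Fin k} (ha : a ∈ 𝒢.pareto) (T : ℕ) :
    𝒢.expect (𝒢.algorithm G c₁ c₂) ν
      (fun h => (h.map fun r => 𝒢.loss r.1 r.2 - 𝒢.loss a r.2).sum) T [] ≤
    max c₂ (2 * cG G) * Real.log 𝒢.pareto.card +
      𝒢.expect (𝒢.algorithm G c₁ c₂) ν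
        (fun h => 𝒢.regretBound G c₁ c₂ (𝒢.observed h)) T [] := by
  have hp := 𝒢.isLearner_algorithm (G := G) hk hc₁ hc₂ hne
  let st : List (Fin k × Fin d) → AlgState k := fun h => 𝒢.algState G c₁ c₂ (𝒢.observed h)
  have hst : ∀ h, IsValid G (st h) := fun h => 𝒢.isValid_algState hc₁ hc₂ hne _
  let U : List (Fin k × Fin d) → ℝ := fun h =>
    (h.map fun r => 𝒢.loss r.1 r.2 - 𝒢.loss a r.2).sum + (-1) * 𝒢.regretBound G c₁ c₂ (𝒢.observed h)
  -- A supermartingale: regret minus its bound, plus the potential. The potential is nonnegative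
  -- because the free energy lies below every coordinate; at the start it equals `β₁ log k_Π`.
  let V : List (Fin k × Fin d) → ℝ := fun h =>
    U h + ((st h).estSum a - 𝒢.freeEnergy (st h).estSum (st h).beta)
  have hV : ∀ h x, ∑ A, 𝒢.algorithm G c₁ c₂ (𝒢.observed h) A * V ((A, x) :: h) ≤ V h := by
    intro h x
    have h1 : ∀ A, V ((A, x) :: h) ≤ (V h - (𝒢.gamma G c₁ (st h) +
        324 * cG G ^ 2 * bOverGammaPrime c₁ (𝒢.bSumNext (st h)) / (st h).beta)) +
        (𝒢.loss A x - 𝒢.loss a x +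
        (𝒢.estSumNext G c₁ (st h) A (𝒢.feedback A x) a - (st h).estSum a) +
        (𝒢.freeEnergy (st h).estSum (st h).beta -
          𝒢.freeEnergy (𝒢.estSumNext G c₁ (st h) A (𝒢.feedback A x)) (st h).beta)) := fun A => by
      have h2 : 𝒢.freeEnergy (st ((A, x) :: h)).estSum (st h).beta ≤
          𝒢.freeEnergy (st ((A, x) :: h)).estSum (st ((A, x) :: h)).beta +
          ((st ((A, x) :: h)).beta - (st h).beta) * 𝒢.entropy (𝒢.qOf (st ((A, x) :: h))) :=
        𝒢.freeEnergy_le _ hne (hst h).beta_pos (hst _).beta_pos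
      have h3 : (st ((A, x) :: h)).estSum = 𝒢.estSumNext G c₁ (st h) A (𝒢.feedback A x) := rfl
      have h4 : 𝒢.regretBound G c₁ c₂ (𝒢.observed ((A, x) :: h)) =
          𝒢.regretBound G c₁ c₂ (𝒢.observed h) + 𝒢.gamma G c₁ (st h) +
          324 * cG G ^ 2 * bOverGammaPrime c₁ (𝒢.bSumNext (st h)) / (st h).beta +
          ((st ((A, x) :: h)).beta - (st h).beta) * 𝒢.entropy (𝒢.qOf (st ((A, x) :: h))) := rfl
      simp only [V, U, h4, List.map_cons, List.sum_cons]
      rw [h3] at h2 ⊢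
      linarith
    have h5 := 𝒢.sum_pOf_mul_le hne hG hc₁ (hst h) ha x
    have h6 : ∑ A, 𝒢.pOf G c₁ (st h) A = 1 := 𝒢.sum_pOf hk hne
    refine (Finset.sum_le_sum fun A _ =>
      mul_le_mul_of_nonneg_left (h1 A) ((hp _).1 A)).trans ?_
    simp only [algorithm, mul_add (_ : ℝ) (V h - _), Finset.sum_add_distrib]
    rw [← Finset.sum_mul, h6, one_mul]
    linarith
  have h1 : 𝒢.expect (𝒢.algorithm G c₁ c₂) ν U T [] ≤ 𝒢.expect (𝒢.algorithm G c₁ c₂) ν V T [] :=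
    𝒢.expect_mono hp hν T [] fun h _ => le_add_of_nonneg_right
      (sub_nonneg.2 (𝒢.freeEnergy_le_apply _ (hst h).beta_pos ha))
  have h2 := 𝒢.expect_le_of_step hp hν hV T []
  have h3 : V [] = max c₂ (2 * cG G) * Real.log 𝒢.pareto.card := by
    have : 𝒢.freeEnergy 0 (max c₂ (2 * cG G)) = _ := 𝒢.freeEnergy_zero _
    simp [V, U, st, observed, algState, regretBound, this]
  rw [𝒢.expect_add, 𝒢.expect_mul] at h1
  linarith

/-- The number of expected pulls of suboptimal actions is at least half of the sum of `b_t`. -/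
theorem expect_gap_ge (hk : 0 < k) (hc₁ : 0 < c₁) (hc₂ : 0 < c₂) (hne : 𝒢.pareto.Nonempty)
    {ν : List (Fin k × Fin d) → Fin d → ℝ} (hν : IsOpponent ν) {Δ : Fin k → ℝ} {δ : ℝ}
    (hδ : 0 ≤ δ) {aStar : Fin k} (h0 : 0 ≤ Δ aStar) (hΔ : ∀ a, a ≠ aStar → δ ≤ Δ a) (T : ℕ) :
    δ / 2 * 𝒢.expect (𝒢.algorithm G c₁ c₂) ν
        (fun h => (𝒢.algState G c₁ c₂ (𝒢.observed h)).bSum) T [] ≤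
      𝒢.expect (𝒢.algorithm G c₁ c₂) ν (fun h => (h.map fun r => Δ r.1).sum) T [] := by
  have hp := 𝒢.isLearner_algorithm (G := G) hk hc₁ hc₂ hne
  let V : List (Fin k × Fin d) → ℝ := fun h =>
    δ / 2 * (𝒢.algState G c₁ c₂ (𝒢.observed h)).bSum + (-1) * (h.map fun r => Δ r.1).sum
  have hV : ∀ h x, ∑ A, 𝒢.algorithm G c₁ c₂ (𝒢.observed h) A * V ((A, x) :: h) ≤ V h := by
    intro h x
    set s := 𝒢.algState G c₁ c₂ (𝒢.observed h) with hs
    have hval : IsValid G s := 𝒢.isValid_algState hc₁ hc₂ hne _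
    have h1 : ∀ A, V ((A, x) :: h) = V h + (δ / 2 * 𝒢.bOf (𝒢.qOf s) + -Δ A) := fun A => by
      have : (𝒢.algState G c₁ c₂ (𝒢.observed ((A, x) :: h))).bSum = s.bSum + 𝒢.bOf (𝒢.qOf s) := rfl
      simp only [V, this, List.map_cons, List.sum_cons, ← hs]
      ring
    simp only [h1, mul_add, Finset.sum_add_distrib, ← Finset.sum_mul, (hp _).2, one_mul]
    simp only [algorithm, ← hs, mul_neg, Finset.sum_neg_distrib]
    have h2 : δ * (1 - 𝒢.pOf G c₁ s aStar) ≤ ∑ A, 𝒢.pOf G c₁ s A * Δ A := by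
      rw [← 𝒢.sum_pOf (G := G) (c₁ := c₁) (s := s) hk hne,
        ← Finset.add_sum_erase _ _ (Finset.mem_univ aStar), add_sub_cancel_left,
        ← Finset.add_sum_erase _ (fun A => 𝒢.pOf G c₁ s A * Δ A) (Finset.mem_univ aStar),
        Finset.mul_sum]
      have h3 := mul_nonneg (𝒢.pOf_pos hne hc₁ hval aStar).le h0
      have h4 : ∑ A ∈ Finset.univ.erase aStar, δ * 𝒢.pOf G c₁ s A ≤
          ∑ A ∈ Finset.univ.erase aStar, 𝒢.pOf G c₁ s A * Δ A := Finset.sum_le_sum fun A hA => by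
        rw [mul_comm]
        exact mul_le_mul_of_nonneg_left (hΔ A (Finset.ne_of_mem_erase hA))
          (𝒢.pOf_pos hne hc₁ hval A).le
      linarith
    have h3 : 𝒢.bOf (𝒢.qOf s) ≤ 1 - 𝒢.qOf s aStar := by
      obtain ⟨m, hm, hb, hmax⟩ := 𝒢.exists_bOf_eq hne (𝒢.qOf s)
      by_cases ha : aStar ∈ 𝒢.pareto
      · linarith [hmax _ ha]
      · have : 𝒢.qOf s aStar = 0 := 𝒢.expWeights_of_notMem _ _ ha
        rw [this, sub_zero]
        exact 𝒢.bOf_qOf_le_one hne s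
    -- Since `γ ≤ 1/2`, mixing in the uniform distribution keeps at least half of the mass that `q`
    -- puts off `aStar`.
    have h4 : 𝒢.bOf (𝒢.qOf s) / 2 ≤ 1 - 𝒢.pOf G c₁ s aStar := by
      have h5 := 𝒢.gamma_le hne hc₁ hval
      have h6 := 𝒢.gamma_pos hne hc₁ hval
      have h7 : 𝒢.gamma G c₁ s / k ≤ 𝒢.gamma G c₁ s :=
        div_le_self h6.le (Nat.one_le_cast.2 hk)
      have h8 := 𝒢.bOf_qOf_nonneg hne s
      rw [pOf]
      nlinarith
    nlinarith [mul_le_mul_of_nonneg_left h4 hδ]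
  have h2 := 𝒢.expect_le_of_step hp hν hV T []
  have h3 : V [] = 0 := by simp [V, observed, algState]
  rw [𝒢.expect_add, 𝒢.expect_mul, 𝒢.expect_mul] at h2
  linarith

end Valid

/-! ### Bounds along a history -/

/-- The sum of the `b_s / γ'_s` along a history. -/
noncomputable def zTotal (𝒢 : PMGame k d S) (G : Fin k → S → Fin k → ℝ) (c₁ c₂ : ℝ) :
    List (Fin k × S) → ℝ
  | [] => 0
  | _ :: h => zTotal 𝒢 G c₁ c₂ h + bOverGammaPrime c₁ (𝒢.bSumNext (𝒢.algState G c₁ c₂ h))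

/-! ### Elementary inequalities that make the sums telescope. -/

theorem rpow_third_pow {B : ℝ} (hB : 0 ≤ B) : (B ^ (1 / 3 : ℝ)) ^ 3 = B := by
  rw [← Real.rpow_natCast, ← Real.rpow_mul hB]
  norm_num

theorem rpow_third_le {B : ℝ} (hB : 0 ≤ B) : B ^ (1 / 3 : ℝ) ≤ 1 + B := by
  have h1 := rpow_third_pow hB
  have h2 : 0 ≤ B ^ (1 / 3 : ℝ) := Real.rpow_nonneg hB _
  nlinarith [sq_nonneg (B ^ (1 / 3 : ℝ) - 1), mul_nonneg h2 (sq_nonneg (B ^ (1 / 3 : ℝ) - 1))]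

/-- A discrete form of `d(u³) = (3/2) u d(u²)`; the defect is `(u - v)² (u + 2v) / 2`. -/
theorem sq_sub_bound {u v : ℝ} (hv : 0 ≤ v) (huv : v ≤ u) :
    u ^ 3 - v ^ 3 ≤ 3 / 2 * (u ^ 2 - v ^ 2) * u := by
  nlinarith [mul_nonneg (sq_nonneg (u - v)) (by linarith : 0 ≤ u + 2 * v)]

/-- Dropping `c₁` from the denominator leaves `c₁ b / (4 B'^{1/3})`, a discrete derivative of
`B^{2/3}`. -/
theorem gammaPrime_step {c₁ B B' : ℝ} (hc₁ : 0 < c₁) (hB : 0 ≤ B) (hBB : B ≤ B') :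
    gammaPrime c₁ (B' - B) B' ≤
      3 / 8 * c₁ * ((B' ^ (1 / 3 : ℝ)) ^ 2 - (B ^ (1 / 3 : ℝ)) ^ 2) := by
  have hv : 0 ≤ B ^ (1 / 3 : ℝ) := Real.rpow_nonneg hB _
  have huv : B ^ (1 / 3 : ℝ) ≤ B' ^ (1 / 3 : ℝ) := Real.rpow_le_rpow hB hBB (by norm_num)
  have h1 := sq_sub_bound hv huv
  rw [rpow_third_pow hB, rpow_third_pow (hB.trans hBB)] at h1
  set u := B' ^ (1 / 3 : ℝ)
  set v := B ^ (1 / 3 : ℝ)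
  have h2 : 0 ≤ u ^ 2 - v ^ 2 := sub_nonneg.2 (pow_le_pow_left₀ hv huv 2)
  have h3 : c₁ * (B' - B) / (c₁ + u) ≤ 3 / 2 * c₁ * (u ^ 2 - v ^ 2) := by
    rw [div_le_iff₀ (by linarith)]
    nlinarith [mul_le_mul_of_nonneg_left h1 hc₁.le, mul_nonneg hc₁.le (mul_nonneg hc₁.le h2)]
  rw [gammaPrime]
  linarith

/-- The denominator of the update of `β` lags one round behind. The factor 13 is that of
`zSum_step`; as `√13 ≤ 4`, one has `√y + √x ≤ 5 √x`. -/
theorem sqrt_step {x y : ℝ} (hx : 0 < x) (hxy : x ≤ y) (hy : y ≤ 13 * x) :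
    (y - x) / √x ≤ 5 * (√y - √x) := by
  have hsx := Real.sqrt_pos.2 hx
  have h1 : √x ≤ √y := Real.sqrt_le_sqrt hxy
  have h2 : √y ≤ 4 * √x := by
    rw [show (4 : ℝ) * √x = √(4 ^ 2 * x) by rw [Real.sqrt_mul (by norm_num),
      Real.sqrt_sq (by norm_num)]]
    exact Real.sqrt_le_sqrt (by linarith)
  rw [div_le_iff₀ hsx]
  nlinarith [Real.sq_sqrt hx.le, Real.sq_sqrt (hx.le.trans hxy)]

theorem log_step {x z : ℝ} (hx : 0 < x) (hz : 0 ≤ z) (hzx : z ≤ 12 * x) :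
    z / x ≤ 13 * (Real.log (x + z) - Real.log x) := by
  rw [← Real.log_div (by positivity) hx.ne']
  have h1 := Real.one_sub_inv_le_log_of_pos (div_pos (by linarith : 0 < x + z) hx)
  have h2 : 1 - ((x + z) / x)⁻¹ = z / (x + z) := by field_simp; ring
  rw [h2] at h1
  refine le_trans ?_ (mul_le_mul_of_nonneg_left h1 (by norm_num))
  rw [mul_div_assoc', div_le_div_iff₀ hx (by linarith)]
  nlinarith

section Path

variable (𝒢 : PMGame k d S) {G : Fin k → S → Fin k → ℝ} {c₁ c₂ : ℝ}

theorem bSum_le_length (hne : 𝒢.pareto.Nonempty) (h : List (Fin k × S)) :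
    (𝒢.algState G c₁ c₂ h).bSum ≤ h.length := by
  induction h with
  | nil => simp [algState]
  | cons r h ih =>
    have h1 := 𝒢.bOf_qOf_le_one hne (𝒢.algState G c₁ c₂ h)
    have h2 : (𝒢.algState G c₁ c₂ (r :: h)).bSum = (𝒢.algState G c₁ c₂ h).bSum +
      𝒢.bOf (𝒢.qOf (𝒢.algState G c₁ c₂ h)) := rfl
    rw [h2, List.length_cons]
    push_cast
    linarith

/-- Each `b_{s+1}` is at most `a_{s+1}`, which `zSum` weights by at least 4. The summand 1 pays for
the first round, whose entropy is not in `zSum`. -/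
theorem bSumNext_le_zSum (hc₁ : 0 < c₁) (hc₂ : 0 < c₂) (hne : 𝒢.pareto.Nonempty)
    (h : List (Fin k × S)) :
    𝒢.bSumNext (𝒢.algState G c₁ c₂ h) ≤ 1 + (𝒢.algState G c₁ c₂ h).zSum / 4 := by
  induction h with
  | nil => simpa [bSumNext, algState] using 𝒢.bOf_qOf_le_one hne (𝒢.algState G c₁ c₂ [])
  | cons r h ih =>
    set s := 𝒢.algState G c₁ c₂ h with hs
    set s' := 𝒢.algState G c₁ c₂ (r :: h) with hs'
    have h1 : s'.bSum = 𝒢.bSumNext s := rfl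
    have h2 : s'.zSum = s.zSum + bOverGammaPrime c₁ (𝒢.bSumNext s) * 𝒢.entropy (𝒢.qOf s') := rfl
    have h3 := 𝒢.bOf_le_entropy hne (𝒢.qOf_pos hne s') (𝒢.sum_pareto_qOf hne s')
    have h4 := four_le_bOverGammaPrime hc₁
      ((𝒢.isValid_algState (G := G) hc₁ hc₂ hne h).bSumNext_nonneg 𝒢 hne)
    have h5 := mul_le_mul_of_nonneg_right h4 (𝒢.entropy_nonneg hne s')
    rw [bSumNext, h1, h2]
    linarith

/-- Here `log k_Π ≤ c₁` is needed: it bounds the increment by `4 (c₁ + B^{1/3})`. Then `B^{1/3} ≤ 1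
+ B ≤ 2 + zSum / 4` and `1 ≤ c₁` give at most `12 c₁ + zSum`. -/
theorem zSum_step (hc₁ : 1 ≤ c₁) (hlog : Real.log 𝒢.pareto.card ≤ c₁) (hc₂ : 0 < c₂)
    (hne : 𝒢.pareto.Nonempty) (r : Fin k × S) (h : List (Fin k × S)) :
    c₁ + (𝒢.algState G c₁ c₂ (r :: h)).zSum ≤ 13 * (c₁ + (𝒢.algState G c₁ c₂ h).zSum) := by
  have hc₀ : 0 < c₁ := by linarith
  have hval := 𝒢.isValid_algState (G := G) hc₀ hc₂ hne h
  set s := 𝒢.algState G c₁ c₂ h with hs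
  set s' := 𝒢.algState G c₁ c₂ (r :: h) with hs'
  have h2 : s'.zSum = s.zSum + bOverGammaPrime c₁ (𝒢.bSumNext s) * 𝒢.entropy (𝒢.qOf s') := rfl
  have h3 : 𝒢.entropy (𝒢.qOf s') ≤ c₁ :=
    (𝒢.entropy_le_log_card hne (𝒢.qOf_pos hne s') (𝒢.sum_pareto_qOf hne s')).trans hlog
  have h4 := four_le_bOverGammaPrime hc₀ (hval.bSumNext_nonneg 𝒢 hne)
  have h5 := mul_le_mul_of_nonneg_left h3 (by linarith : 0 ≤ bOverGammaPrime c₁ (𝒢.bSumNext s))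
  have h6 : bOverGammaPrime c₁ (𝒢.bSumNext s) * c₁ = 4 * (c₁ + 𝒢.bSumNext s ^ (1 / 3 : ℝ)) := by
    rw [bOverGammaPrime, div_mul_cancel₀ _ hc₀.ne']
  have h7 := rpow_third_le (hval.bSumNext_nonneg 𝒢 hne)
  have h8 := 𝒢.bSumNext_le_zSum (G := G) hc₀ hc₂ hne h
  have h9 := hval.zSum_nonneg
  rw [h2]
  linarith

/-- The first two bounds keep one increment below 12 times `1 + zTotal`, as `log_step` requires; the
last makes `log (1 + zTotal)` of order `log T`. -/
theorem zTotal_bounds (hc₁ : 1 ≤ c₁) (hc₂ : 0 < c₂) (hne : 𝒢.pareto.Nonempty)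
    (h : List (Fin k × S)) :
    4 * (h.length : ℝ) ≤ 𝒢.zTotal G c₁ c₂ h ∧
      bOverGammaPrime c₁ (𝒢.bSumNext (𝒢.algState G c₁ c₂ h)) ≤ 12 + 4 * h.length ∧
      𝒢.zTotal G c₁ c₂ h ≤ 12 * h.length + 2 * (h.length : ℝ) ^ 2 := by
  have hc₀ : 0 < c₁ := by linarith
  have key : ∀ h : List (Fin k × S),
      bOverGammaPrime c₁ (𝒢.bSumNext (𝒢.algState G c₁ c₂ h)) ≤ 12 + 4 * h.length := fun h => by
    have hval := 𝒢.isValid_algState (G := G) hc₀ hc₂ hne h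
    have h1 := rpow_third_le (hval.bSumNext_nonneg 𝒢 hne)
    have h2 := 𝒢.bSum_le_length (G := G) (c₁ := c₁) (c₂ := c₂) hne h
    have h3 := 𝒢.bOf_qOf_le_one hne (𝒢.algState G c₁ c₂ h)
    have h4 : 𝒢.bSumNext (𝒢.algState G c₁ c₂ h) ≤ h.length + 1 := add_le_add h2 h3
    have h5 : (0 : ℝ) ≤ h.length := Nat.cast_nonneg _
    rw [bOverGammaPrime, div_le_iff₀ hc₀]
    nlinarith
  refine ⟨?_, key h, ?_⟩
  · induction h with
    | nil => simp [zTotal]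
    | cons r h ih =>
      have := four_le_bOverGammaPrime hc₀
        ((𝒢.isValid_algState (G := G) hc₀ hc₂ hne h).bSumNext_nonneg 𝒢 hne)
      rw [zTotal, List.length_cons]
      push_cast
      linarith
  · induction h with
    | nil => simp [zTotal]
    | cons r h ih =>
      have := key h
      rw [zTotal, List.length_cons]
      push_cast
      nlinarith

/-- The denominators in the update only grow, so each may be replaced by the latest; the 1 comes
from `β₁ ≥ c₂`. -/
theorem beta_ge_zTotal (hc₁ : 1 ≤ c₁) (hc₂ : 0 < c₂) (hne : 𝒢.pareto.Nonempty)
    (h : List (Fin k × S)) :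
    c₂ * (1 + 𝒢.zTotal G c₁ c₂ h) / √(c₁ + (𝒢.algState G c₁ c₂ h).zSum) ≤
      (𝒢.algState G c₁ c₂ h).beta := by
  have hc₀ : 0 < c₁ := by linarith
  induction h with
  | nil =>
    have h1 : (1 : ℝ) ≤ √(c₁ + 0) := Real.one_le_sqrt.2 (by linarith)
    have h2 : c₂ * (1 + 0) / √(c₁ + 0) ≤ c₂ := by
      rw [add_zero, mul_one]
      exact div_le_self hc₂.le h1
    exact h2.trans (le_max_left _ _)
  | cons r h ih =>
    have hval := 𝒢.isValid_algState (G := G) hc₀ hc₂ hne h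
    have h1 := four_le_bOverGammaPrime hc₀ (hval.bSumNext_nonneg 𝒢 hne)
    have h5 := (𝒢.zTotal_bounds (G := G) hc₁ hc₂ hne (r :: h)).1
    have h6 : (0 : ℝ) ≤ (r :: h).length := Nat.cast_nonneg _
    set s := 𝒢.algState G c₁ c₂ h with hs
    set s' := 𝒢.algState G c₁ c₂ (r :: h) with hs'
    have h2 : s'.zSum = s.zSum + bOverGammaPrime c₁ (𝒢.bSumNext s) * 𝒢.entropy (𝒢.qOf s') := rfl
    have h3 : s'.beta = s.beta +
      c₂ * bOverGammaPrime c₁ (𝒢.bSumNext s) / √(c₁ + s.zSum) := rfl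
    have h4 : 0 < √(c₁ + s.zSum) := Real.sqrt_pos.2 (by linarith [hval.zSum_nonneg])
    have h7 : √(c₁ + s.zSum) ≤ √(c₁ + s'.zSum) := Real.sqrt_le_sqrt (by
      rw [h2]
      linarith [mul_nonneg (by linarith : 0 ≤ bOverGammaPrime c₁ (𝒢.bSumNext s))
        (𝒢.entropy_nonneg hne s')])
    calc c₂ * (1 + 𝒢.zTotal G c₁ c₂ (r :: h)) / √(c₁ + s'.zSum)
        ≤ c₂ * (1 + 𝒢.zTotal G c₁ c₂ (r :: h)) / √(c₁ + s.zSum) := by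
          gcongr
          exact mul_nonneg hc₂.le (by linarith)
      _ = c₂ * (1 + 𝒢.zTotal G c₁ c₂ h) / √(c₁ + s.zSum) +
          c₂ * bOverGammaPrime c₁ (𝒢.bSumNext s) / √(c₁ + s.zSum) := by
          rw [zTotal, ← add_div]
          ring
      _ ≤ s'.beta := by rw [h3]; linarith

/-- Every term telescopes: exploration by `gammaPrime_step`; the penalty by `sqrt_step`, being `c₂`
times the increment of `zSum` over a square root; stability by `beta_ge_zTotal` and `log_step`. The
part `c_𝒢 / (2β)` of the exploration joins the stability term, whence `4225 = (324 + 1) * 13`. -/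
theorem regretBound_le (hc₁ : 1 ≤ c₁) (hlog : Real.log 𝒢.pareto.card ≤ c₁) (hc₂ : 0 < c₂)
    (hne : 𝒢.pareto.Nonempty) (h : List (Fin k × S)) :
    𝒢.regretBound G c₁ c₂ h ≤
      3 / 8 * c₁ * ((𝒢.algState G c₁ c₂ h).bSum ^ (1 / 3 : ℝ)) ^ 2 +
      (4225 * (cG G ^ 2 * Real.log (1 + 𝒢.zTotal G c₁ c₂ h) / c₂) + 5 * c₂) *
        √(c₁ + (𝒢.algState G c₁ c₂ h).zSum) := by
  have hc₀ : 0 < c₁ := by linarith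
  induction h with
  | nil =>
    simp only [regretBound, zTotal, algState, add_zero, Real.log_one]
    positivity
  | cons r h ih =>
    have hval := 𝒢.isValid_algState (G := G) hc₀ hc₂ hne h
    have hB := hval.bSumNext_nonneg 𝒢 hne
    have hz := four_le_bOverGammaPrime hc₀ hB
    obtain ⟨hS, hzS, -⟩ := 𝒢.zTotal_bounds (G := G) hc₁ hc₂ hne h
    have hn : (0 : ℝ) ≤ h.length := Nat.cast_nonneg _
    have hβ := 𝒢.beta_ge_zTotal (G := G) hc₁ hc₂ hne h
    have hstep := 𝒢.zSum_step (G := G) hc₁ hlog hc₂ hne r h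
    have hST : 𝒢.zTotal G c₁ c₂ (r :: h) = 𝒢.zTotal G c₁ c₂ h +
      bOverGammaPrime c₁ (𝒢.bSumNext (𝒢.algState G c₁ c₂ h)) := rfl
    have hR : 𝒢.regretBound G c₁ c₂ (r :: h) = 𝒢.regretBound G c₁ c₂ h +
      𝒢.gamma G c₁ (𝒢.algState G c₁ c₂ h) +
      324 * cG G ^ 2 * bOverGammaPrime c₁ (𝒢.bSumNext (𝒢.algState G c₁ c₂ h)) /
        (𝒢.algState G c₁ c₂ h).beta +
      ((𝒢.algState G c₁ c₂ (r :: h)).beta - (𝒢.algState G c₁ c₂ h).beta) *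
        𝒢.entropy (𝒢.qOf (𝒢.algState G c₁ c₂ (r :: h))) := rfl
    rw [hR, hST]
    set s := 𝒢.algState G c₁ c₂ h with hs
    set s' := 𝒢.algState G c₁ c₂ (r :: h) with hs'
    set z := bOverGammaPrime c₁ (𝒢.bSumNext s)
    set W := 𝒢.zTotal G c₁ c₂ h
    have h1 : s'.bSum = 𝒢.bSumNext s := rfl
    have h2 : s'.zSum = s.zSum + z * 𝒢.entropy (𝒢.qOf s') := rfl
    have h3 : s'.beta = s.beta + c₂ * z / √(c₁ + s.zSum) := rfl
    have ha := 𝒢.entropy_nonneg hne s'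
    have hpos : 0 < c₁ + s.zSum := by linarith [hval.zSum_nonneg]
    have hsq := Real.sqrt_pos.2 hpos
    have hzz : c₁ + s.zSum ≤ c₁ + s'.zSum := by
      rw [h2]
      linarith [mul_nonneg (by linarith : 0 ≤ z) ha]
    have hsqle := Real.sqrt_le_sqrt hzz
    have e1 := gammaPrime_step hc₀ hval.bSum_nonneg (𝒢.bSum_le_bSumNext hne s)
    rw [show 𝒢.bSumNext s - s.bSum = 𝒢.bOf (𝒢.qOf s) from add_sub_cancel_left _ _, ← h1] at e1
    have e2 : (s'.beta - s.beta) * 𝒢.entropy (𝒢.qOf s') ≤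
        5 * c₂ * (√(c₁ + s'.zSum) - √(c₁ + s.zSum)) := by
      have := mul_le_mul_of_nonneg_left (sqrt_step hpos hzz hstep) hc₂.le
      calc _ = c₂ * ((c₁ + s'.zSum - (c₁ + s.zSum)) / √(c₁ + s.zSum)) := by
            rw [h3, h2]
            ring
        _ ≤ _ := by linarith
    have hcG := one_le_cG G
    have hβ0 := hval.beta_pos
    have hW : 0 < 1 + W := by linarith
    have e3 : z / s.beta ≤ 13 * (Real.log (1 + (W + z)) - Real.log (1 + W)) / c₂ *
        √(c₁ + s'.zSum) := by
      have h4 := log_step hW (by linarith : 0 ≤ z) (by linarith)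
      rw [add_assoc] at h4
      have h5 : 0 ≤ z / (1 + W) := div_nonneg (by linarith) hW.le
      calc z / s.beta ≤ z / (c₂ * (1 + W) / √(c₁ + s.zSum)) := by gcongr
        _ = z / (1 + W) / c₂ * √(c₁ + s.zSum) := by field_simp
        _ ≤ _ := by
          have h6 := h5.trans h4
          gcongr
    have e4 : 𝒢.gamma G c₁ s + 324 * cG G ^ 2 * z / s.beta ≤
        gammaPrime c₁ (𝒢.bOf (𝒢.qOf s)) (𝒢.bSumNext s) + 325 * cG G ^ 2 * (z / s.beta) := by
      have h4 : cG G / (2 * s.beta) ≤ cG G ^ 2 * (z / s.beta) := by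
        rw [mul_div_assoc', div_le_div_iff₀ (by positivity) hβ0]
        have : cG G ≤ cG G ^ 2 * z * 2 := by nlinarith
        nlinarith [mul_le_mul_of_nonneg_right this hβ0.le]
      rw [gamma]
      have h5 : 324 * cG G ^ 2 * z / s.beta = 324 * (cG G ^ 2 * (z / s.beta)) := by ring
      linarith
    have e5 := mul_le_mul_of_nonneg_left e3 (by positivity : 0 ≤ 325 * cG G ^ 2)
    have hlogW : 0 ≤ Real.log (1 + W) := Real.log_nonneg (by linarith)
    have e6 : 4225 * (cG G ^ 2 * Real.log (1 + W) / c₂) * √(c₁ + s.zSum) ≤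
        4225 * (cG G ^ 2 * Real.log (1 + W) / c₂) * √(c₁ + s'.zSum) := by gcongr
    have e7 : 325 * cG G ^ 2 * (13 * (Real.log (1 + (W + z)) - Real.log (1 + W)) / c₂ *
        √(c₁ + s'.zSum)) = 4225 * (cG G ^ 2 * Real.log (1 + (W + z)) / c₂) * √(c₁ + s'.zSum) -
        4225 * (cG G ^ 2 * Real.log (1 + W) / c₂) * √(c₁ + s'.zSum) := by ring
    rw [← h1] at e4
    linarith

/-- The ratio `b / γ'` increases with `B`, so the latest one dominates; the entropies are bounded by
`entropy_le`. Because `zSum` pairs round `s` with the entropy of round `s + 1`, the sum of the `b`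
extends one round further. -/
theorem zSum_le (hc₁ : 0 < c₁) (hc₂ : 0 < c₂) (hne : 𝒢.pareto.Nonempty) {T : ℝ} (hT : 1 ≤ T)
    (h : List (Fin k × S)) :
    (𝒢.algState G c₁ c₂ h).zSum ≤ bOverGammaPrime c₁ (𝒢.algState G c₁ c₂ h).bSum *
      ((1 + Real.log (𝒢.pareto.card * T)) * 𝒢.bSumNext (𝒢.algState G c₁ c₂ h) +
        h.length / T) := by
  have hL : 0 ≤ Real.log (𝒢.pareto.card * T) := Real.log_nonneg
    (one_le_mul_of_one_le_of_one_le (Nat.one_le_cast.2 hne.card_pos) hT)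
  have hT0 : 0 < T := by linarith
  induction h with
  | nil =>
    have h1 := four_le_bOverGammaPrime (B := 0) hc₁ le_rfl
    have h2 : 0 ≤ 𝒢.bSumNext (𝒢.algState G c₁ c₂ []) :=
      (𝒢.isValid_algState (G := G) hc₁ hc₂ hne []).bSumNext_nonneg 𝒢 hne
    exact mul_nonneg (by linarith : (0 : ℝ) ≤ bOverGammaPrime c₁ 0) (by positivity)
  | cons r h ih =>
    have hval := 𝒢.isValid_algState (G := G) hc₁ hc₂ hne h
    have hB := hval.bSumNext_nonneg 𝒢 hne
    have h0 := 𝒢.bSum_le_bSumNext hne (𝒢.algState G c₁ c₂ h)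
    set s := 𝒢.algState G c₁ c₂ h with hs
    set s' := 𝒢.algState G c₁ c₂ (r :: h) with hs'
    have h1 : s'.bSum = 𝒢.bSumNext s := rfl
    have h2 : s'.zSum = s.zSum + bOverGammaPrime c₁ (𝒢.bSumNext s) * 𝒢.entropy (𝒢.qOf s') := rfl
    have h3 := 𝒢.entropy_le hne (𝒢.qOf_pos hne s') (𝒢.sum_pareto_qOf hne s') hT0
    have h4 : bOverGammaPrime c₁ s.bSum ≤ bOverGammaPrime c₁ (𝒢.bSumNext s) := by
      have := Real.rpow_le_rpow hval.bSum_nonneg h0 (by norm_num : (0 : ℝ) ≤ 1 / 3)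
      unfold bOverGammaPrime
      gcongr
    have h5 := four_le_bOverGammaPrime hc₁ hB
    have h6 : 𝒢.bSumNext s' = 𝒢.bSumNext s + 𝒢.bOf (𝒢.qOf s') := by rw [bSumNext, h1]
    have h7 := mul_le_mul_of_nonneg_right h4 (by positivity : 0 ≤
      (1 + Real.log (𝒢.pareto.card * T)) * 𝒢.bSumNext s + h.length / T)
    have h8 := mul_le_mul_of_nonneg_left h3
      (by linarith : 0 ≤ bOverGammaPrime c₁ (𝒢.bSumNext s))
    rw [h1, h2, h6, List.length_cons]
    push_cast
    rw [add_div]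
    linarith

end Path

/-! ### The regret bounds -/

/-- Parameters `c₁`, `c₂` of the orders `rate ^ (1 / 3)` and `cG * √(log T)`. -/
structure IsTuned (𝒢 : PMGame k d S) (G : Fin k → S → Fin k → ℝ) (T : ℕ)
    (κ₁ κ₁' κ₂ κ₂' c₁ c₂ : ℝ) : Prop where
  nonempty : 𝒢.pareto.Nonempty
  three_le : 3 ≤ T
  κ₁_pos : 0 < κ₁
  κ₁_le : κ₁ ≤ κ₁'
  κ₂_pos : 0 < κ₂
  κ₂_le : κ₂ ≤ κ₂'
  one_le : 1 ≤ c₁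
  log_le : Real.log 𝒢.pareto.card ≤ c₁
  le_c₁ : κ₁ * 𝒢.rate G T ^ (1 / 3 : ℝ) ≤ c₁
  c₁_le : c₁ ≤ κ₁' * 𝒢.rate G T ^ (1 / 3 : ℝ)
  le_c₂ : κ₂ * √(cG G ^ 2 * Real.log T) ≤ c₂
  c₂_le : c₂ ≤ κ₂' * √(cG G ^ 2 * Real.log T)

theorem one_le_log_of_three_le {x : ℝ} (hx : 3 ≤ x) : 1 ≤ Real.log x := by
  rw [Real.le_log_iff_exp_le (by linarith)]
  linarith [Real.exp_one_lt_d9]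

/-- Read `ξ³` as the rate, `u³` as `B` and `r` as `κ₁⁻¹`. Replacing 1 by `ξ³` makes the claim
essentially the homogeneous inequality `(u³ + ξ³)(ξ + u) ≤ 2 (ξ² + u²)²`. -/
theorem cross_term_bound {ξ u r : ℝ} (hξ : 1 ≤ ξ) (hu : 0 ≤ u) (hr : 0 ≤ r) :
    ξ ^ 3 * ((u ^ 3 + 1) * (1 + u * r / ξ)) ≤ 2 * (1 + r) * (ξ * (ξ ^ 2 + u ^ 2)) ^ 2 := by
  have hξ0 : 0 < ξ := by linarith
  have h1 : ξ ^ 3 * ((u ^ 3 + 1) * (1 + u * r / ξ)) = ξ ^ 2 * ((u ^ 3 + 1) * (ξ + u * r)) := by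
    field_simp
  have h2 : (1 : ℝ) ≤ ξ ^ 3 := one_le_pow₀ hξ
  have h3 : (u ^ 3 + ξ ^ 3) * (ξ + u) ≤ 2 * (ξ ^ 2 + u ^ 2) ^ 2 := by
    nlinarith [sq_nonneg (u * (u - ξ)), sq_nonneg (ξ * (u - ξ)), sq_nonneg (u * ξ),
      sq_nonneg (u ^ 2 - ξ ^ 2), sq_nonneg (u - ξ)]
  have h4 : ξ + u * r ≤ (1 + r) * (ξ + u) := by nlinarith [mul_nonneg hξ0.le hr]
  have h5 : 0 ≤ u ^ 3 := pow_nonneg hu 3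
  have h6 : 0 ≤ ξ + u * r := by positivity
  rw [h1]
  calc ξ ^ 2 * ((u ^ 3 + 1) * (ξ + u * r))
      ≤ ξ ^ 2 * ((u ^ 3 + ξ ^ 3) * ((1 + r) * (ξ + u))) := by gcongr
    _ = ξ ^ 2 * (1 + r) * ((u ^ 3 + ξ ^ 3) * (ξ + u)) := by ring
    _ ≤ ξ ^ 2 * (1 + r) * (2 * (ξ ^ 2 + u ^ 2) ^ 2) := by gcongr
    _ = _ := by ring

/-- Linearizes `B^{2/3}` in `B = u³`, so that expectations can be taken. Whichever of `ξ` and `η u`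
is larger decides which term dominates. -/
theorem young_bound {ξ u η : ℝ} (hξ : 0 ≤ ξ) (hu : 0 ≤ u) (hη : 0 < η) :
    ξ * u ^ 2 ≤ ξ ^ 3 / η ^ 2 + η * u ^ 3 := by
  rcases le_total ξ (η * u) with h | h
  · have h1 : ξ * u ^ 2 ≤ η * u * u ^ 2 := by gcongr
    have h2 : 0 ≤ ξ ^ 3 / η ^ 2 := by positivity
    linarith [(by ring : η * u * u ^ 2 = η * u ^ 3)]
  · have h1 : (η * u) ^ 2 ≤ ξ ^ 2 := pow_le_pow_left₀ (by positivity) h 2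
    have h2 : ξ * u ^ 2 ≤ ξ ^ 3 / η ^ 2 := by
      rw [le_div_iff₀ (by positivity)]
      nlinarith [mul_le_mul_of_nonneg_left h1 hξ]
    have h3 : 0 ≤ η * u ^ 3 := by positivity
    linarith

/-- The constant in the regret bound. -/
noncomputable def tunedConst (κ₁ κ₁' κ₂ κ₂' : ℝ) : ℝ :=
  3 / 8 * κ₁' + (16900 / κ₂ + 5 * κ₂') * √(κ₁' + 24 * (1 + κ₁⁻¹)) + κ₂' + 2

section Tuned

variable {𝒢 : PMGame k d S} {G : Fin k → S → Fin k → ℝ} {T : ℕ} {κ₁ κ₁' κ₂ κ₂' c₁ c₂ : ℝ}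

theorem IsTuned.one_le_log (hp : 𝒢.IsTuned G T κ₁ κ₁' κ₂ κ₂' c₁ c₂) : 1 ≤ Real.log T :=
  one_le_log_of_three_le (by exact_mod_cast hp.three_le)

theorem IsTuned.one_le_log_mul (hp : 𝒢.IsTuned G T κ₁ κ₁' κ₂ κ₂' c₁ c₂) :
    1 ≤ Real.log (𝒢.pareto.card * T) := by
  refine one_le_log_of_three_le ?_
  have h1 : (1 : ℝ) ≤ 𝒢.pareto.card := Nat.one_le_cast.2 hp.nonempty.card_pos
  have h2 : (3 : ℝ) ≤ T := by exact_mod_cast hp.three_le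
  nlinarith

theorem IsTuned.one_le_sq (hp : 𝒢.IsTuned G T κ₁ κ₁' κ₂ κ₂' c₁ c₂) :
    1 ≤ cG G ^ 2 * Real.log T :=
  one_le_mul_of_one_le_of_one_le (one_le_pow₀ (one_le_cG G)) hp.one_le_log

theorem IsTuned.one_le_rate (hp : 𝒢.IsTuned G T κ₁ κ₁' κ₂ κ₂' c₁ c₂) : 1 ≤ 𝒢.rate G T :=
  one_le_mul_of_one_le_of_one_le hp.one_le_sq hp.one_le_log_mul

theorem IsTuned.c₂_pos (hp : 𝒢.IsTuned G T κ₁ κ₁' κ₂ κ₂' c₁ c₂) : 0 < c₂ :=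
  (mul_pos hp.κ₂_pos (Real.sqrt_pos.2 (by linarith [hp.one_le_sq]))).trans_le hp.le_c₂

theorem IsTuned.tunedConst_pos (hp : 𝒢.IsTuned G T κ₁ κ₁' κ₂ κ₂' c₁ c₂) :
    0 < tunedConst κ₁ κ₁' κ₂ κ₂' := by
  have h1 := hp.κ₁_pos
  have h2 := hp.κ₂_pos
  have h3 := h1.trans_le hp.κ₁_le
  have h4 := h2.trans_le hp.κ₂_le
  unfold tunedConst
  positivity

/-- The square of the leading factor in `regretBound_le`, up to constants. -/
theorem IsTuned.sqrt_mul_sqrt_le (hp : 𝒢.IsTuned G T κ₁ κ₁' κ₂ κ₂' c₁ c₂)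
    {h : List (Fin k × S)} (hT : h.length = T) :
    √(cG G ^ 2 * Real.log T) * √(c₁ + (𝒢.algState G c₁ c₂ h).zSum) ≤
      √(κ₁' + 24 * (1 + κ₁⁻¹)) * (𝒢.rate G T ^ (1 / 3 : ℝ) * ((𝒢.rate G T ^ (1 / 3 : ℝ)) ^ 2 +
        ((𝒢.algState G c₁ c₂ h).bSum ^ (1 / 3 : ℝ)) ^ 2)) := by
  have hc₀ : 0 < c₁ := by linarith [hp.one_le]
  have hval := 𝒢.isValid_algState (G := G) hc₀ hp.c₂_pos hp.nonempty h
  have hT1 : (1 : ℝ) ≤ T := by exact_mod_cast (by linarith [hp.three_le] : 1 ≤ T)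
  have hZ := 𝒢.zSum_le (G := G) hc₀ hp.c₂_pos hp.nonempty hT1 h
  rw [hT, div_self (by linarith)] at hZ
  have hM := hp.one_le_sq
  have hL := hp.one_le_log_mul
  have hX := hp.one_le_rate
  have hle := hp.le_c₁
  have hc₁le := hp.c₁_le
  have hκ := hp.κ₁_pos
  have hκ' := hκ.trans_le hp.κ₁_le
  have hB1 : 𝒢.bSumNext (𝒢.algState G c₁ c₂ h) ≤ (𝒢.algState G c₁ c₂ h).bSum + 1 :=
    add_le_add_right (𝒢.bOf_qOf_le_one hp.nonempty _) _
  have hB := hval.bSum_nonneg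
  have hXdef : 𝒢.rate G T = cG G ^ 2 * Real.log T * Real.log (𝒢.pareto.card * T) := rfl
  set s := 𝒢.algState G c₁ c₂ h
  set M := cG G ^ 2 * Real.log T
  set L := Real.log (𝒢.pareto.card * T)
  have hξ3 := rpow_third_pow (by linarith : 0 ≤ 𝒢.rate G T)
  have hu3 := rpow_third_pow hB
  have hξ : 1 ≤ 𝒢.rate G T ^ (1 / 3 : ℝ) := Real.one_le_rpow hX (by norm_num)
  have hu : 0 ≤ s.bSum ^ (1 / 3 : ℝ) := Real.rpow_nonneg hB _
  rw [bOverGammaPrime] at hZ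
  set ξ := 𝒢.rate G T ^ (1 / 3 : ℝ)
  set u := s.bSum ^ (1 / 3 : ℝ)
  have hξ0 : 0 < ξ := by linarith
  have hz : 4 * (c₁ + u) / c₁ ≤ 4 * (1 + u * κ₁⁻¹ / ξ) := by
    have : u / c₁ ≤ u / (κ₁ * ξ) := by gcongr
    calc 4 * (c₁ + u) / c₁ = 4 * (1 + u / c₁) := by field_simp
      _ ≤ 4 * (1 + u / (κ₁ * ξ)) := by linarith
      _ = _ := by field_simp
  -- The `1 / T` remainders have summed to 1; since `1 ≤ L`, it and the factor `1 + L` fit into `3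
  -- L`.
  have hZ' : s.zSum ≤ 4 * (1 + u * κ₁⁻¹ / ξ) * (3 * L * (u ^ 3 + 1)) := by
    refine hZ.trans (mul_le_mul hz ?_ ?_ (by positivity))
    · rw [hu3]
      have h1 := mul_le_mul_of_nonneg_left hB1 (by linarith : 0 ≤ 1 + L)
      have h2 := mul_le_mul_of_nonneg_right hL (by linarith : 0 ≤ s.bSum + 1)
      nlinarith
    · have := hval.bSumNext_nonneg 𝒢 hp.nonempty
      positivity
  have hcross := cross_term_bound hξ hu (inv_nonneg.2 hκ.le)
  have hMX : M ≤ ξ ^ 3 := by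
    rw [hξ3, hXdef]
    exact le_mul_of_one_le_right (by linarith) hL
  have h1 : M * c₁ ≤ κ₁' * (ξ * (ξ ^ 2 + u ^ 2)) ^ 2 := by
    calc M * c₁ ≤ ξ ^ 3 * (κ₁' * ξ) := mul_le_mul hMX hc₁le hc₀.le (by positivity)
      _ = κ₁' * (ξ ^ 4 * 1) := by ring
      _ ≤ κ₁' * (ξ ^ 4 * ξ ^ 2) := by
        gcongr
        exact one_le_pow₀ hξ
      _ = κ₁' * (ξ * (ξ ^ 2 + 0)) ^ 2 := by ring
      _ ≤ _ := by
        gcongr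
        positivity
  have h2 : M * s.zSum ≤ 24 * (1 + κ₁⁻¹) * (ξ * (ξ ^ 2 + u ^ 2)) ^ 2 := by
    calc M * s.zSum ≤ M * (4 * (1 + u * κ₁⁻¹ / ξ) * (3 * L * (u ^ 3 + 1))) := by gcongr
      _ = 12 * (ξ ^ 3 * ((u ^ 3 + 1) * (1 + u * κ₁⁻¹ / ξ))) := by rw [hξ3, hXdef]; ring
      _ ≤ _ := by linarith
  rw [← Real.sqrt_mul (by linarith)]
  refine Real.sqrt_le_iff.2 ⟨by positivity, ?_⟩
  rw [mul_pow, Real.sq_sqrt (by positivity)]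
  linarith

theorem IsTuned.log_zTotal_le (hp : 𝒢.IsTuned G T κ₁ κ₁' κ₂ κ₂' c₁ c₂)
    {h : List (Fin k × S)} (hT : h.length = T) :
    Real.log (1 + 𝒢.zTotal G c₁ c₂ h) ≤ 4 * Real.log T := by
  obtain ⟨h1, -, h2⟩ := 𝒢.zTotal_bounds (G := G) hp.one_le hp.c₂_pos hp.nonempty h
  have hT3 : (3 : ℝ) ≤ T := by exact_mod_cast hp.three_le
  rw [hT] at h1 h2
  have h3 : 4 * Real.log T = Real.log ((T : ℝ) ^ 4) := by simp
  rw [h3]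
  refine Real.log_le_log (by linarith) ?_
  have h4 : (9 : ℝ) ≤ (T : ℝ) ^ 2 := by nlinarith
  have h5 : 9 * (T : ℝ) ^ 2 ≤ (T : ℝ) ^ 4 := by
    nlinarith [mul_le_mul_of_nonneg_right h4 (sq_nonneg (T : ℝ))]
  nlinarith

/-- The bound along a history of length `T`, including the initial penalty. -/
theorem IsTuned.regretBound_le (hp : 𝒢.IsTuned G T κ₁ κ₁' κ₂ κ₂' c₁ c₂)
    {h : List (Fin k × S)} (hT : h.length = T) {η : ℝ} (hη : 0 < η) :
    max c₂ (2 * cG G) * Real.log 𝒢.pareto.card + 𝒢.regretBound G c₁ c₂ h ≤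
      tunedConst κ₁ κ₁' κ₂ κ₂' * (𝒢.rate G T + 𝒢.rate G T / η ^ 2 +
        η * (𝒢.algState G c₁ c₂ h).bSum) := by
  have hc₀ : 0 < c₁ := by linarith [hp.one_le]
  have hc₂ := hp.c₂_pos
  have hval := 𝒢.isValid_algState (G := G) hc₀ hc₂ hp.nonempty h
  have hR := 𝒢.regretBound_le (G := G) hp.one_le hp.log_le hc₂ hp.nonempty h
  have hlog := hp.log_zTotal_le hT
  have hsq := hp.sqrt_mul_sqrt_le hT
  have hM := hp.one_le_sq
  have hL := hp.one_le_log_mul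
  have hX := hp.one_le_rate
  have hB := hval.bSum_nonneg
  have hκ₁ := hp.κ₁_pos
  have hκ₁' := hκ₁.trans_le hp.κ₁_le
  have hκ₂ := hp.κ₂_pos
  have hκ₂' := hκ₂.trans_le hp.κ₂_le
  have hlec := hp.le_c₂
  have hcle := hp.c₂_le
  have hc₁le := hp.c₁_le
  have hcG := one_le_cG G
  have hlogT := hp.one_le_log
  have hT1 : (1 : ℝ) ≤ T := by exact_mod_cast (by linarith [hp.three_le] : 1 ≤ T)
  have hcard : (1 : ℝ) ≤ 𝒢.pareto.card := Nat.one_le_cast.2 hp.nonempty.card_pos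
  have hlogk : Real.log 𝒢.pareto.card ≤ Real.log (𝒢.pareto.card * T) :=
    Real.log_le_log (by linarith) (le_mul_of_one_le_right (by linarith) hT1)
  have hlogk0 : 0 ≤ Real.log 𝒢.pareto.card := Real.log_nonneg hcard
  have hXdef : 𝒢.rate G T = cG G ^ 2 * Real.log T * Real.log (𝒢.pareto.card * T) := rfl
  have hξ3 := rpow_third_pow (by linarith : 0 ≤ 𝒢.rate G T)
  have hu3 := rpow_third_pow hB
  have hξ : 1 ≤ 𝒢.rate G T ^ (1 / 3 : ℝ) := Real.one_le_rpow hX (by norm_num)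
  have hu : 0 ≤ (𝒢.algState G c₁ c₂ h).bSum ^ (1 / 3 : ℝ) := Real.rpow_nonneg hB _
  set s := 𝒢.algState G c₁ c₂ h
  set ξ := 𝒢.rate G T ^ (1 / 3 : ℝ)
  set u := s.bSum ^ (1 / 3 : ℝ)
  set D := √(κ₁' + 24 * (1 + κ₁⁻¹))
  set m := √(cG G ^ 2 * Real.log T) with hm
  have hm2 : m ^ 2 = cG G ^ 2 * Real.log T := Real.sq_sqrt (by linarith)
  have hm1 : 1 ≤ m := Real.one_le_sqrt.2 hM
  have hm0 : 0 < m := by linarith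
  have hξ0 : 0 < ξ := by linarith
  have hcGm : cG G ≤ m := Real.le_sqrt_of_sq_le (le_mul_of_one_le_right (by positivity) hlogT)
  have e1 : max c₂ (2 * cG G) * Real.log 𝒢.pareto.card ≤ (κ₂' + 2) * ξ ^ 3 := by
    have h1 : max c₂ (2 * cG G) ≤ (κ₂' + 2) * m := max_le (by nlinarith) (by nlinarith)
    have h2 : m ≤ m ^ 2 := by nlinarith
    calc _ ≤ (κ₂' + 2) * m * Real.log (𝒢.pareto.card * T) := by gcongr
      _ ≤ (κ₂' + 2) * m ^ 2 * Real.log (𝒢.pareto.card * T) := by gcongr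
      _ = _ := by rw [hξ3, hXdef, hm2]; ring
  -- `16900 = 4225 * 4`, with the 4 from `log_zTotal_le`.
  have e2 : 4225 * (cG G ^ 2 * Real.log (1 + 𝒢.zTotal G c₁ c₂ h) / c₂) + 5 * c₂ ≤
      (16900 / κ₂ + 5 * κ₂') * m := by
    have h1 : cG G ^ 2 * Real.log (1 + 𝒢.zTotal G c₁ c₂ h) / c₂ ≤ 4 * m / κ₂ := by
      calc _ ≤ cG G ^ 2 * (4 * Real.log T) / (κ₂ * m) := by gcongr
        _ = 4 * m ^ 2 / (κ₂ * m) := by rw [hm2]; ring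
        _ = _ := by field_simp
    have h2 : 4225 * (4 * m / κ₂) = 16900 / κ₂ * m := by ring
    linarith
  have e3 : (4225 * (cG G ^ 2 * Real.log (1 + 𝒢.zTotal G c₁ c₂ h) / c₂) + 5 * c₂) *
      √(c₁ + s.zSum) ≤ (16900 / κ₂ + 5 * κ₂') * D * (ξ * (ξ ^ 2 + u ^ 2)) := by
    calc _ ≤ (16900 / κ₂ + 5 * κ₂') * m * √(c₁ + s.zSum) := by gcongr
      _ = (16900 / κ₂ + 5 * κ₂') * (m * √(c₁ + s.zSum)) := by ring
      _ ≤ (16900 / κ₂ + 5 * κ₂') * (D * (ξ * (ξ ^ 2 + u ^ 2))) := by gcongr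
      _ = _ := by ring
  have e4 : 3 / 8 * c₁ * u ^ 2 ≤ 3 / 8 * κ₁' * (ξ * (ξ ^ 2 + u ^ 2)) := by
    calc 3 / 8 * c₁ * u ^ 2 ≤ 3 / 8 * (κ₁' * ξ) * u ^ 2 := by gcongr
      _ = 3 / 8 * κ₁' * (ξ * (0 + u ^ 2)) := by ring
      _ ≤ _ := by
        gcongr
        positivity
  have e5 : (κ₂' + 2) * ξ ^ 3 ≤ (κ₂' + 2) * (ξ * (ξ ^ 2 + u ^ 2)) := by
    have : 0 ≤ ξ * u ^ 2 := by positivity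
    gcongr
    linarith [(by ring : ξ * (ξ ^ 2 + u ^ 2) = ξ ^ 3 + ξ * u ^ 2)]
  have e6 : ξ * (ξ ^ 2 + u ^ 2) ≤ 𝒢.rate G T + 𝒢.rate G T / η ^ 2 + η * s.bSum := by
    have := young_bound hξ0.le hu hη
    rw [hξ3, hu3] at this
    rw [mul_add, ← pow_succ', hξ3]
    linarith
  refine le_trans ?_ (mul_le_mul_of_nonneg_left e6 hp.tunedConst_pos.le)
  unfold tunedConst
  linarith

/-- The regret in terms of the expected value of `∑ b_t`. -/
theorem IsTuned.regret_le (hp : 𝒢.IsTuned G T κ₁ κ₁' κ₂ κ₂' c₁ c₂) (hk : 0 < k) (hd : 0 < d)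
    (hdup : 𝒢.NoDuplicates) (hG : 𝒢.IsPathEstimator G) {ν : List (Fin k × Fin d) → Fin d → ℝ}
    (hν : IsOpponent ν) {η : ℝ} (hη : 0 < η) :
    𝒢.regret (𝒢.algorithm G c₁ c₂) ν T ≤
      tunedConst κ₁ κ₁' κ₂ κ₂' * (𝒢.rate G T + 𝒢.rate G T / η ^ 2 +
        η * 𝒢.expect (𝒢.algorithm G c₁ c₂) ν
          (fun h => (𝒢.algState G c₁ c₂ (𝒢.observed h)).bSum) T []) := by
  have hc₀ : 0 < c₁ := by linarith [hp.one_le]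
  have hl := 𝒢.isLearner_algorithm (G := G) hk hc₀ hp.c₂_pos hp.nonempty
  have : Nonempty (Fin k) := ⟨⟨0, hk⟩⟩
  refine ciSup_le fun a => ?_
  obtain ⟨b, hb, hab⟩ := 𝒢.exists_pareto_expect_le hk hd hdup hl hν
    (by linarith [hp.three_le] : 0 < T) a
  refine hab.trans ((𝒢.expect_regret_le hk hc₀ hp.c₂_pos hp.nonempty hG hν hb T).trans ?_)
  rw [← 𝒢.expect_const hl hν (max c₂ (2 * cG G) * Real.log 𝒢.pareto.card) T [], ← expect_add]
  refine (𝒢.expect_mono hl hν T [] fun h hh =>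
    hp.regretBound_le (h := 𝒢.observed h) (by simpa [observed] using hh) hη).trans_eq ?_
  rw [expect_mul, expect_add, expect_mul, 𝒢.expect_const hl hν]

end Tuned

end PMGame

/-! ### The choice of `η` in the two regimes. -/

namespace PMGame

variable {k d : ℕ} {S : Type*}

theorem regret_le_length (𝒢 : PMGame k d S) (hk : 0 < k) {p : List (Fin k × S) → Fin k → ℝ}
    {ν : List (Fin k × Fin d) → Fin d → ℝ} (hp : IsLearner p) (hν : IsOpponent ν) (T : ℕ) :
    𝒢.regret p ν T ≤ T := by
  have : Nonempty (Fin k) := ⟨⟨0, hk⟩⟩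
  refine ciSup_le fun a => ?_
  refine (𝒢.expect_mono hp hν T [] fun h hh => ?_).trans_eq (𝒢.expect_const hp hν (T : ℝ) T [])
  have h1 : ((h.map fun r => 𝒢.loss r.1 r.2 - 𝒢.loss a r.2).length : ℝ) = T := by
    simpa using congrArg (Nat.cast (R := ℝ)) hh
  rw [← h1, ← nsmul_one]
  refine List.sum_le_card_nsmul _ _ fun y hy => ?_
  obtain ⟨r, -, rfl⟩ := List.mem_map.1 hy
  linarith [(𝒢.loss_mem r.1 r.2).2, (𝒢.loss_mem a r.2).1]

theorem regret_eq_zero [Subsingleton (Fin k)] (𝒢 : PMGame k d S) (hk : 0 < k)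
    {p : List (Fin k × S) → Fin k → ℝ} {ν : List (Fin k × Fin d) → Fin d → ℝ} (hp : IsLearner p)
    (hν : IsOpponent ν) (T : ℕ) : 𝒢.regret p ν T = 0 := by
  have : Nonempty (Fin k) := ⟨⟨0, hk⟩⟩
  have h1 : ∀ (a : Fin k) (h : List (Fin k × Fin d)),
      (h.map fun r => 𝒢.loss r.1 r.2 - 𝒢.loss a r.2).sum = 0 := fun a h => by
    refine List.sum_eq_zero fun y hy => ?_
    obtain ⟨r, -, rfl⟩ := List.mem_map.1 hy
    rw [Subsingleton.elim r.1 a, sub_self]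
  simp only [regret, h1, 𝒢.expect_const hp hν, ciSup_const]

theorem gapMin_bounds {Δ : Fin k → ℝ} {aStar : Fin k} (hΔ : ∀ a, Δ a ∈ Set.Icc (0 : ℝ) 1)
    (hpos : ∀ a, a ≠ aStar → 0 < Δ a) [Nontrivial (Fin k)] :
    0 < gapMin Δ aStar ∧ gapMin Δ aStar ≤ 1 ∧ ∀ a, a ≠ aStar → gapMin Δ aStar ≤ Δ a := by
  obtain ⟨b, hb⟩ := exists_ne aStar
  have : Nonempty {a : Fin k // a ≠ aStar} := ⟨⟨b, hb⟩⟩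
  have hle : ∀ a, a ≠ aStar → gapMin Δ aStar ≤ Δ a := fun a ha =>
    ciInf_le (f := fun a : {a : Fin k // a ≠ aStar} => Δ a) (Set.finite_range _).bddBelow ⟨a, ha⟩
  obtain ⟨c, hc⟩ := exists_eq_ciInf_of_finite (f := fun a : {a : Fin k // a ≠ aStar} => Δ a)
  refine ⟨?_, (hle b hb).trans (hΔ b).2, hle⟩
  rw [gapMin, ← hc]
  exact hpos c c.2

/-- Optimizing the parameter in the adversarial regime. -/
theorem le_of_tuned_adversarial {K X R E T : ℝ} (hK : 0 < K) (hX : 1 ≤ X) (hT : 1 ≤ T)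
    (hR : ∀ η : ℝ, 0 < η → R ≤ K * (X + X / η ^ 2 + η * E)) (hE : E ≤ T) (hRT : R ≤ T) :
    R ≤ (3 * K + 1) * (X ^ (1 / 3 : ℝ) * T ^ (2 / 3 : ℝ)) := by
  have hX3 := rpow_third_pow (by linarith : 0 ≤ X)
  have hT3 := rpow_third_pow (by linarith : 0 ≤ T)
  have hT2 : T ^ (2 / 3 : ℝ) = (T ^ (1 / 3 : ℝ)) ^ 2 := by
    rw [← Real.rpow_natCast, ← Real.rpow_mul (by linarith)]
    norm_num
  have hξ0 : 0 < X ^ (1 / 3 : ℝ) := Real.rpow_pos_of_pos (by linarith) _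
  have hτ0 : 0 < T ^ (1 / 3 : ℝ) := Real.rpow_pos_of_pos (by linarith) _
  rw [hT2]
  set ξ := X ^ (1 / 3 : ℝ)
  set τ := T ^ (1 / 3 : ℝ)
  -- For `X ≤ T` the choice `η = (X / T)^{1/3}` balances `X / η²` with `η T`; otherwise the trivial
  -- bound `R ≤ T` is good enough.
  rcases le_total ξ τ with h | h
  · have h1 := hR (ξ / τ) (by positivity)
    have h2 : X / (ξ / τ) ^ 2 = ξ * τ ^ 2 := by
      rw [← hX3]
      field_simp
    have h3 : ξ / τ * E ≤ ξ * τ ^ 2 := by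
      calc ξ / τ * E ≤ ξ / τ * T := by gcongr
        _ = ξ * τ ^ 2 := by rw [← hT3]; field_simp
    have h4 : X ≤ ξ * τ ^ 2 := by
      rw [← hX3, pow_succ']
      gcongr
    have h5 : 0 ≤ ξ * τ ^ 2 := by positivity
    calc R ≤ K * (X + X / (ξ / τ) ^ 2 + ξ / τ * E) := h1
      _ ≤ K * (ξ * τ ^ 2 + ξ * τ ^ 2 + ξ * τ ^ 2) := by
        rw [h2]
        gcongr
      _ ≤ _ := by linarith
  · have h1 : T ≤ ξ * τ ^ 2 := by
      rw [← hT3, pow_succ']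
      gcongr
    have h2 : 0 ≤ K * (ξ * τ ^ 2) := by positivity
    linarith

/-- Optimizing the parameter under a self-bounding constraint. -/
theorem le_of_tuned_selfBounding {K X R E δ C : ℝ} (hK : 0 < K) (hX : 1 ≤ X) (hδ : 0 < δ)
    (hδ1 : δ ≤ 1) (hC : 0 ≤ C) (hR : ∀ η : ℝ, 0 < η → R ≤ K * (X + X / η ^ 2 + η * E))
    (hE : δ / 2 * E - C ≤ R) :
    R ≤ (2 * K + 32 * K ^ 3 + 1) * (X / δ ^ 2 + (C ^ 2 * X / δ ^ 2) ^ (1 / 3 : ℝ)) := by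
  -- With `η = δ l / (4 K)` the last term is `(l / 2)(δ E / 2) ≤ (l / 2)(R + C)`; as `l ≤ 1`, half
  -- of a positive `R` absorbs its share. The free `l` weighs `C` against the rate.
  have key : ∀ l : ℝ, 0 < l → l ≤ 1 →
      R ≤ (2 * K + 32 * K ^ 3) * (X / δ ^ 2 / l ^ 2) + l * C := by
    intro l hl hl1
    have h1 := hR (δ * l / (4 * K)) (by positivity)
    have h2 : X / (δ * l / (4 * K)) ^ 2 = 16 * K ^ 2 * (X / δ ^ 2 / l ^ 2) := by
      field_simp
      ring
    have h3 : K * (δ * l / (4 * K) * E) = l / 2 * (δ / 2 * E) := by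
      field_simp
      ring
    have h4 : X ≤ X / δ ^ 2 / l ^ 2 := by
      rw [div_div]
      refine le_div_self (by linarith) (by positivity) ?_
      rw [← mul_pow]
      exact pow_le_one₀ (by positivity) (mul_le_one₀ hδ1 hl.le hl1)
    rw [h2] at h1
    set Y := X / δ ^ 2 / l ^ 2
    have h5 : l / 2 * (δ / 2 * E) ≤ l / 2 * (R + C) := by
      gcongr
      linarith
    have h6 : R ≤ (K + 16 * K ^ 3) * Y + l / 2 * (R + C) := by
      have h7 : K * X ≤ K * Y := by gcongr
      linarith [(by ring : K * (X + 16 * K ^ 2 * Y + δ * l / (4 * K) * E) =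
        K * X + 16 * K ^ 3 * Y + K * (δ * l / (4 * K) * E))]
    have h8 : 0 ≤ (K + 16 * K ^ 3) * Y := by positivity
    rcases le_or_gt R 0 with h9 | h9
    · have : 0 ≤ l * C := by positivity
      linarith
    · nlinarith
  have hY : 0 < X / δ ^ 2 := by positivity
  rw [show C ^ 2 * X / δ ^ 2 = C ^ 2 * (X / δ ^ 2) by ring]
  set Y := X / δ ^ 2
  have hK3 : 0 < K ^ 3 := by positivity
  -- The terms `Y / l²` and `l C` balance at `l = (Y / C)^{1/3}`, admissible only if `Y ≤ C`; for
  -- smaller `C` take `l = 1`.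
  rcases le_or_gt C Y with h | h
  · have h1 := key 1 one_pos le_rfl
    have h2 : 0 ≤ (C ^ 2 * Y) ^ (1 / 3 : ℝ) := by positivity
    have h3 : 0 ≤ (2 * K + 32 * K ^ 3 + 1) * (C ^ 2 * Y) ^ (1 / 3 : ℝ) := by positivity
    rw [one_pow, div_one, one_mul] at h1
    linarith
  · have hC0 : 0 < C := hY.trans h
    have hy3 := rpow_third_pow hY.le
    have hc3 := rpow_third_pow hC
    have hy0 : 0 < Y ^ (1 / 3 : ℝ) := Real.rpow_pos_of_pos hY _
    have hc0 : 0 < C ^ (1 / 3 : ℝ) := Real.rpow_pos_of_pos hC0 _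
    have hyc : Y ^ (1 / 3 : ℝ) ≤ C ^ (1 / 3 : ℝ) := Real.rpow_le_rpow hY.le h.le (by norm_num)
    have h1 : (C ^ 2 * Y) ^ (1 / 3 : ℝ) = (C ^ (1 / 3 : ℝ)) ^ 2 * Y ^ (1 / 3 : ℝ) := by
      rw [Real.mul_rpow (by positivity) hY.le, ← Real.rpow_natCast, ← Real.rpow_natCast,
        ← Real.rpow_mul hC, ← Real.rpow_mul hC, mul_comm ((2 : ℕ) : ℝ)]
    rw [h1]
    set y := Y ^ (1 / 3 : ℝ)
    set c := C ^ (1 / 3 : ℝ)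
    have h2 := key (y / c) (by positivity) ((div_le_one hc0).2 hyc)
    have h3 : Y / (y / c) ^ 2 = c ^ 2 * y := by
      rw [← hy3]
      field_simp
    have h4 : y / c * C = c ^ 2 * y := by
      rw [← hc3]
      field_simp
    rw [h3, h4] at h2
    have h5 : 0 ≤ (2 * K + 32 * K ^ 3 + 1) * Y := by positivity
    linarith

end PMGame

theorem mainTheorem2 (κ₁ κ₁' κ₂ κ₂' : ℝ) (hκ₁ : 0 < κ₁) (hκ₁' : κ₁ ≤ κ₁') (hκ₂ : 0 < κ₂)
    (hκ₂' : κ₂ ≤ κ₂') :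
    ∃ K : ℝ, 0 < K ∧
      ∀ (k d : ℕ) (S : Type*) [Fintype S] (𝒢 : PMGame k d S), 0 < k → 0 < d →
        𝒢.NoDuplicates → 𝒢.GloballyObservable →
        (∃ G, 𝒢.IsPathEstimator G) ∧
        ∀ G, 𝒢.IsPathEstimator G → ∀ T : ℕ, 3 ≤ T → ∀ c₁ c₂ : ℝ,
          max 1 (Real.log 𝒢.pareto.card) ≤ c₁ →
          κ₁ * 𝒢.rate G T ^ (1 / 3 : ℝ) ≤ c₁ → c₁ ≤ κ₁' * 𝒢.rate G T ^ (1 / 3 : ℝ) →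
          κ₂ * Real.sqrt (PMGame.cG G ^ 2 * Real.log T) ≤ c₂ →
          c₂ ≤ κ₂' * Real.sqrt (PMGame.cG G ^ 2 * Real.log T) →
          PMGame.IsLearner (𝒢.algorithm G c₁ c₂) ∧
          ∀ ν : List (Fin k × Fin d) → Fin d → ℝ, PMGame.IsOpponent ν →
            (∀ (Δ : Fin k → ℝ) (C : ℝ) (aStar : Fin k),
              (∀ a, Δ a ∈ Set.Icc (0 : ℝ) 1) → 0 ≤ C → (∀ a, a ≠ aStar → 0 < Δ a) →
              𝒢.SelfBounding ν Δ C T →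
              𝒢.regret (𝒢.algorithm G c₁ c₂) ν T ≤
                K * (𝒢.rate G T / PMGame.gapMin Δ aStar ^ 2 +
                  (C ^ 2 * 𝒢.rate G T / PMGame.gapMin Δ aStar ^ 2) ^ (1 / 3 : ℝ))) ∧
            𝒢.regret (𝒢.algorithm G c₁ c₂) ν T ≤
              K * (𝒢.rate G T ^ (1 / 3 : ℝ) * (T : ℝ) ^ (2 / 3 : ℝ)) := by
  have hκ₁0 := hκ₁.trans_le hκ₁'
  have hκ₂0 := hκ₂.trans_le hκ₂'
  have hK₀ : 0 < PMGame.tunedConst κ₁ κ₁' κ₂ κ₂' := by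
    unfold PMGame.tunedConst
    positivity
  set K₀ := PMGame.tunedConst κ₁ κ₁' κ₂ κ₂' with hK₀def
  -- Dominates the constants of both regimes, `2 K₀ + 32 K₀³ + 1` and `3 K₀ + 1`.
  refine ⟨3 * K₀ + 32 * K₀ ^ 3 + 1, by positivity, ?_⟩
  intro k d S _ 𝒢 hk hd hdup hobs
  refine ⟨𝒢.exists_isPathEstimator hk hd hdup hobs, ?_⟩
  intro G hG T hT c₁ c₂ hc₁ h1 h2 h3 h4
  have hp : 𝒢.IsTuned G T κ₁ κ₁' κ₂ κ₂' c₁ c₂ := ⟨𝒢.pareto_nonempty hk hd hdup, hT, hκ₁, hκ₁',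
    hκ₂, hκ₂', (le_max_left _ _).trans hc₁, (le_max_right _ _).trans hc₁, h1, h2, h3, h4⟩
  have hc₀ : 0 < c₁ := by linarith [hp.one_le]
  have hl := 𝒢.isLearner_algorithm (G := G) hk hc₀ hp.c₂_pos hp.nonempty
  have hX := hp.one_le_rate
  refine ⟨hl, fun ν hν => ?_⟩
  have hR := fun η (hη : 0 < η) => hp.regret_le hk hd hdup hG hν hη
  rw [← hK₀def] at hR
  constructor
  · intro Δ C aStar hΔ hC hpos hself
    -- With one action `gapMin` is an infimum over an empty type, so the quotients take default
    -- values; the regret is zero and the right side nonnegative.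
    rcases subsingleton_or_nontrivial (Fin k) with hk1 | hk1
    · rw [𝒢.regret_eq_zero hk hl hν]
      positivity
    · obtain ⟨hδ, hδ1, hδΔ⟩ := PMGame.gapMin_bounds hΔ hpos
      have hgap := 𝒢.expect_gap_ge (G := G) hk hc₀ hp.c₂_pos hp.nonempty hν hδ.le (hΔ aStar).1
        hδΔ T
      have hself' := hself _ hl
      simp only [sub_eq_add_neg] at hself'
      rw [PMGame.expect_add, 𝒢.expect_const hl hν] at hself'
      refine (PMGame.le_of_tuned_selfBounding hK₀ hX hδ hδ1 hC hR (by linarith)).trans ?_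
      gcongr
      norm_num
  · have hT1 : (1 : ℝ) ≤ T := by exact_mod_cast (by linarith : 1 ≤ T)
    have hE : 𝒢.expect (𝒢.algorithm G c₁ c₂) ν
        (fun h => (𝒢.algState G c₁ c₂ (𝒢.observed h)).bSum) T [] ≤ T := by
      refine (𝒢.expect_mono hl hν T [] fun h hh => ?_).trans_eq
        (𝒢.expect_const hl hν (T : ℝ) T [])
      refine (𝒢.bSum_le_length hp.nonempty _).trans_eq ?_
      simpa [PMGame.observed] using hh
    refine (PMGame.le_of_tuned_adversarial hK₀ hX hT1 hR hE
      (𝒢.regret_le_length hk hl hν T)).trans ?_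
    have : 0 < K₀ ^ 3 := by positivity
    gcongr
    linarith
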